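/- **Setting.** Let $\mathbb H$ be a separable real Hilbert space (of finite or countably infinite dimension) and let $(x,y)$ be a random pair in $\mathbb H\times\mathbb R$ with $\mathbb E\|x\|^4<\infty$ and $\mathbb E y^2<\infty$. Put $\mathrm{ReLU}(a)=\max\{a,0\}$, $L(w)=\mathbb E\big(\mathrm{ReLU}(x^\top w)-y\big)^2$ for $w\in\mathbb H$, $\mathrm{OPT}=\min_{w\in\mathbb H}L(w)$, and $H=\mathbb E[xx^\top]=\sum_{i\ge1}\lambda_i v_iv_i^\top$ with eigenvalues $\lambda_1\ge\lambda_2\ge\dots\ge 0$ and orthonormal eigenvectors $v_i$ (in finite dimension the sequence is continued by $\lambda_i=0$, $v_i=0$). Write $\|v\|_A^2=v^\top Av$, $I_{0:k}=\sum_{i\le k}v_iv_i^\top$, $H_{k:\infty}=\sum_{i>k}\lambda_iv_iv_i^\top$, and $\preceq$ for the Loewner order. Assume: 1. (Symmetry) for all $u,v\in\mathbb H$, $\mathbb E[xx^\top\mathbf 1\{x^\top u>0,x^\top v>0\}]=\mathbb E[xx^\top\mathbf 1\{x^\top u<0,x^\top v<0\}]$ and $\mathbb E[(x^\top v)^2xx^\top\mathbf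 1\{x^\top u>0,x^\top v>0\}]=\mathbb E[(x^\top v)^2xx^\top\mathbf 1\{x^\top u<0,x^\top v<0\}]$. 2. (Upper hypercontractivity) there is $\alpha>0$ such that $\mathbb E[xx^\top Axx^\top]\preceq\alpha\,\mathrm{tr}(HA)\,H$ for every bounded positive semidefinite operator $A$. 3. (Misspecified noise) there are $w_*\in\arg\min L$ and $\sigma^2>0$ such that $\mathbb E\big[(y-\mathrm{ReLU}(x^\top w_*))^2xx^\top\big]\preceq\sigma^2H$. **Algorithm.** Let $N>100$, let $(x_t,y_t)_{t=1}^N$ be i.i.d. copies of $(x,y)$, let $N_{\mathrm{eff}}=N/\log_2N$, and let $K$ be $N_{\mathrm{eff}}$ rounded down or up to an integer. Given $\gamma_0>0$ let, for $t\ge1$, $\gamma_t=\gamma_{t-1}/2$ if $K$ divides $t$ and $\gamma_t=\gamma_{t-1}$ otherwise. Given $w_0\in\mathbb H$, GLM-tron computes $$w_t=w_{t-1}-\gamma_t\big(\mathrm{ReLU}(x_t^\top w_{t-1})-y_t\big)x_t,\qquad t=1,\dots,N.$$ **Theorem (risk bound for GLM-tron, misspecified case).** There is an absolute constant $C>0$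 such that, in this setting, if $0<\gamma_0<1/(8\alpha\,\mathrm{tr}(H))$ (any $\gamma_0>0$ if $H=0$), then for every integer $k\ge0$ $$\mathbb E\,L(w_N)\le C\Big(\mathrm{OPT}+\Big\|\prod_{t=1}^N\Big(I-\frac{\gamma_t}2H\Big)(w_0-w_*)\Big\|_H^2+(1+\mathrm{SNR})\,\sigma^2\,\frac{D_{\mathrm{eff}}}{N_{\mathrm{eff}}}\Big),$$ where $$D_{\mathrm{eff}}=k+N_{\mathrm{eff}}^2\gamma_0^2\sum_{i>k}\lambda_i^2,\qquad \mathrm{SNR}=\frac{\alpha}{\sigma^2}\Big(\mathrm{OPT}+\|w_*\|_H^2+\|w_0-w_*\|^2_{\frac{1}{N_{\mathrm{eff}}\gamma_0}I_{0:k}+H_{k:\infty}}\Big).$$ Moreover, if $\lambda_i\ge1/(N_{\mathrm{eff}}\gamma_0)$ for all $i\le k$, then $\mathrm{SNR}\le\alpha\big(\mathrm{OPT}+\|w_*\|_H^2+\|w_0-w_*\|_H^2\big)/\sigma^2$. -/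

import Mathlib

open MeasureTheory ProbabilityTheory
open scoped RealInnerProductSpace

noncomputable section

namespace GLMTron

/-- The rectified linear unit. -/
def relu (a : ℝ) : ℝ := max a 0

/-- The geometrically decaying stepsizes with epoch length `K`:
the stepsize is halved at every positive multiple of `K`. -/
def stepSize (K : ℕ) (γ₀ : ℝ) : ℕ → ℝ
  | 0 => γ₀
  | t + 1 => if (t + 1) % K = 0 then stepSize K γ₀ t / 2 else stepSize K γ₀ t

section Hilbert

variable {E : Type*} [NormedAddCommGroup E] [InnerProductSpace ℝ E]

/-- The rank-one operator `x xᵀ`. -/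
def outer (x : E) : E →L[ℝ] E := InnerProductSpace.rankOne ℝ x x

/-- The squared (semi)norm `‖v‖²_A = vᵀ A v`. -/
def sqNorm (A : E →L[ℝ] E) (v : E) : ℝ := ⟪v, A v⟫

/-- The iterates `w_t` of GLM-tron on the data `z_t = (x_t, y_t)`, `t ≥ 1`, with stepsizes `γ_t`:
`w_t = w_{t-1} - γ_t (ReLU(x_tᵀ w_{t-1}) - y_t) x_t`. -/
def iterate (γ : ℕ → ℝ) (w₀ : E) (z : ℕ → E × ℝ) : ℕ → E
  | 0 => w₀
  | t + 1 =>
      iterate γ w₀ z t -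
        (γ (t + 1) * (relu ⟪(z (t + 1)).1, iterate γ w₀ z t⟫ - (z (t + 1)).2)) • (z (t + 1)).1

/-- `∏_{t=1}^N (I - (γ_t / 2) H)`. -/
def contraction (γ : ℕ → ℝ) (H : E →L[ℝ] E) (N : ℕ) : E →L[ℝ] E :=
  ((List.range N).map fun t => 1 - (γ (t + 1) / 2) • H).prod

/-- `H = ∑ᵢ λᵢ vᵢ vᵢᵀ` with eigenvalues `λᵢ` in non-increasing order and orthonormal eigenvectors
`vᵢ`, indexed from `0` here (so the first `k` eigenpairs are those with index `< k`). When the eigenpairs run out (for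
instance in finite dimension) the sequence is continued by `λᵢ = 0`, `vᵢ = 0`. -/
structure IsEigendecomposition (H : E →L[ℝ] E) (lam : ℕ → ℝ) (v : ℕ → E) : Prop where
  antitone : Antitone lam
  nonneg : ∀ i, 0 ≤ lam i
  orthogonal : ∀ i j, i ≠ j → ⟪v i, v j⟫ = 0
  norm_eq : ∀ i, ‖v i‖ = 1 ∨ (lam i = 0 ∧ v i = 0)
  hasSum : ∀ w, HasSum (fun i => lam i • outer (v i) w) (H w)

/-- `I_{0:k}`, the sum of `vᵢ vᵢᵀ` over the first `k` indices. -/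
def headProj (v : ℕ → E) (k : ℕ) : E →L[ℝ] E := ∑ i ∈ Finset.range k, outer (v i)

/-- `H_{k:∞}`, the sum of `λᵢ vᵢ vᵢᵀ` over all but the first `k` indices. -/
def tailOp (lam : ℕ → ℝ) (v : ℕ → E) (k : ℕ) : E →L[ℝ] E := ∑' i, lam (k + i) • outer (v (k + i))

/-- The effective dimension `k + N_eff² γ₀² ∑ λᵢ²`, the sum being over all but the first `k`
indices. -/
def effDim (lam : ℕ → ℝ) (Neff γ₀ : ℝ) (k : ℕ) : ℝ := k + Neff ^ 2 * γ₀ ^ 2 * ∑' i, lam (k + i) ^ 2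

/-- The trace of an operator, `∑ᵢ ⟨bᵢ, T bᵢ⟩` over an orthonormal basis `b`; it is only used for
trace-class operators, where the choice of the basis does not matter. -/
def trace [CompleteSpace E] (T : E →L[ℝ] E) : ℝ :=
  ∑' b : (exists_hilbertBasis ℝ E).choose, ⟪(b : E), T b⟫

variable [MeasurableSpace E]

/-- The risk `L(w) = E (ReLU(xᵀ w) - y)²`, where `(x, y)` has law `D`. -/
def risk (D : Measure (E × ℝ)) (w : E) : ℝ := ∫ p, (relu ⟪p.1, w⟫ - p.2) ^ 2 ∂D

/-- `OPT`, the minimum risk. -/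
def opt (D : Measure (E × ℝ)) : ℝ := ⨅ w, risk D w

/-- The data covariance `H = E[x xᵀ]`. -/
def cov (D : Measure (E × ℝ)) : E →L[ℝ] E := ∫ p, outer p.1 ∂D

/-- The second and fourth moments of the features on a sector are invariant under sign flip. -/
structure SymmetricFeatures (D : Measure (E × ℝ)) : Prop where
  second : ∀ u v : E,
    ∫ p in {p | 0 < ⟪p.1, u⟫ ∧ 0 < ⟪p.1, v⟫}, outer p.1 ∂D =
      ∫ p in {p | ⟪p.1, u⟫ < 0 ∧ ⟪p.1, v⟫ < 0}, outer p.1 ∂D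
  fourth : ∀ u v : E,
    ∫ p in {p | 0 < ⟪p.1, u⟫ ∧ 0 < ⟪p.1, v⟫}, ⟪p.1, v⟫ ^ 2 • outer p.1 ∂D =
      ∫ p in {p | ⟪p.1, u⟫ < 0 ∧ ⟪p.1, v⟫ < 0}, ⟪p.1, v⟫ ^ 2 • outer p.1 ∂D

/-- Upper hypercontractivity: the fourth moment of `x` is finite and
`E[x xᵀ A x xᵀ] ⪯ α tr(H A) H` for every positive semidefinite `A`
(`x xᵀ A x xᵀ = (xᵀ A x) x xᵀ`; the order is the Loewner order). -/
structure UpperHypercontractive [CompleteSpace E] (D : Measure (E × ℝ)) (α : ℝ) : Prop where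
  pos : 0 < α
  memLp : MemLp (fun p : E × ℝ => p.1) 4 D
  le : ∀ A : E →L[ℝ] E, A.IsPositive →
    ∫ p, outer p.1 * A * outer p.1 ∂D ≤ (α * trace (cov D * A)) • cov D

/-- Misspecified noise: the response has a finite second moment (so that all risks are finite),
`w_*` minimizes the risk, and `E[(y - ReLU(xᵀ w_*))² x xᵀ]` exists and is `⪯ σ² H`, `σ² > 0`. -/
structure MisspecifiedNoise (D : Measure (E × ℝ)) (wstar : E) (σ : ℝ) : Prop where
  pos : 0 < σ
  memLp : MemLp (fun p : E × ℝ => p.2) 2 D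
  isMin : ∀ w, risk D wstar ≤ risk D w
  integrable : Integrable (fun p : E × ℝ => (p.2 - relu ⟪p.1, wstar⟫) ^ 2 • outer p.1) D
  le : ∫ p, (p.2 - relu ⟪p.1, wstar⟫) ^ 2 • outer p.1 ∂D ≤ σ ^ 2 • cov D

/-- `z_1, …, z_N` are independent with common law `D`. -/
structure IsIIDSample {Ω : Type*} [MeasurableSpace Ω] (P : Measure Ω) (D : Measure (E × ℝ))
    (N : ℕ) (z : ℕ → Ω → E × ℝ) : Prop where
  hasLaw : ∀ t ∈ Finset.Icc 1 N, HasLaw (z t) D P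
  indep : iIndepFun (fun t : Fin N => z (t + 1)) P

/-- The signal-to-noise ratio
`α (OPT + ‖w_*‖²_H + ‖w₀ - w_*‖²_{I_{0:k}/(N_eff γ₀) + H_{k:∞}}) / σ²`. -/
def snr (D : Measure (E × ℝ)) (α σ : ℝ) (w₀ wstar : E) (lam : ℕ → ℝ) (v : ℕ → E)
    (Neff γ₀ : ℝ) (k : ℕ) : ℝ :=
  α * (opt D + sqNorm (cov D) wstar +
    sqNorm ((1 / (Neff * γ₀)) • headProj v k + tailOp lam v k) (w₀ - wstar)) / σ ^ 2

end Hilbert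

end GLMTron

end

open GLMTron

universe u v

open MeasureTheory ProbabilityTheory
open scoped RealInnerProductSpace

noncomputable section

namespace GLMTron

set_option linter.unusedSectionVars false

/-! By symmetry the ReLU keeps exactly half of the second moment, so E[ReLU(xᵀw) x] = Hw/2 and the
mean GLM-tron step is affine (`integral_relu_mul_inner`). Let b formally solve Hb = E[(y -
ReLU(xᵀw_*)) x]. The mean step multiplies w - w_* - 2b by I - γH/2, so misspecification only moves
the fixed point. The series b need not converge in the space, but its eigencoordinates make sense,
and a Bessel-type argument gives ∑ λᵢbᵢ² ≤ OPT (`sum_biasCoord_sq_le`). Recentring therefore costs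
only multiples of OPT.

Let y_{t,i} be the second moment of the i-th recentred coordinate. Hypercontractivity and the noise
assumption give (`integral_step_sq_le`, `coordMoment_map_le`) y_{t+1,i} ≤ (1 - γλᵢ/2)² y_{t,i} +
γ²λᵢ(4α ∑ⱼ λⱼy_{t,j} + R), with R = 16α OPT + 2σ². The directions interact only through the scalar
∑ⱼ λⱼy_{t,j}, and the stepsize condition keeps this feedback at most about one half.

The rest is a deterministic study of this system (`MomentSystem.risk_le`). While the stepsize is
still γ₀, the time average of the scalar is of order A + R/α, where A is the initial error weighted
by min(λᵢ, 1/((K-1)γ₀)) (`sum_risk_le`). Hence the scalar is small at some early time, and by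
stability it stays so (`risk_le_of_le`). The noise level is then O(αA + R), and each direction
retains its contracted initial error plus noise O((αA + R) K min(γ₀²λᵢ², 1/K²)) (`coord_le`): the
first entry of the minimum comes from summing squared stepsizes, the second from forgetting old
noise. Summing over i and splitting at index k yields D_eff / N_eff. -/

/-! ### Stepsizes and scalar recursions in one eigendirection -/

lemma one_sub_pow_mul_le_one {u : ℝ} (h0 : 0 ≤ u) (h1 : u ≤ 1) (n : ℕ) :
    (1 - u) ^ n * (1 + n * u) ≤ 1 := by
  -- Bernoulli for 1 + u, combined with (1 - u)(1 + u) ≤ 1. The outcome is used as the polynomial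
  -- decay (1 - u)^n ≤ 1 / (1 + nu).
  have hb : 1 + n * u ≤ (1 + u) ^ n := one_add_mul_le_pow (by linarith) n
  calc (1 - u) ^ n * (1 + n * u) ≤ (1 - u) ^ n * (1 + u) ^ n :=
        mul_le_mul_of_nonneg_left hb (pow_nonneg (by linarith) n)
    _ = (1 - u ^ 2) ^ n := by rw [← mul_pow]; ring_nf
    _ ≤ 1 := pow_le_one₀ (by nlinarith) (by nlinarith)

lemma stepSize_eq (K : ℕ) (γ₀ : ℝ) (t : ℕ) :
    stepSize K γ₀ t = γ₀ / 2 ^ (t / K) := by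
  induction t with
  | zero => simp [stepSize]
  | succ t ih =>
    rw [stepSize, ih, Nat.succ_div]
    by_cases h : K ∣ t + 1
    · rw [if_pos (Nat.mod_eq_zero_of_dvd h), if_pos h, pow_succ, div_div]
    · rw [if_neg (fun h' => h (Nat.dvd_of_mod_eq_zero h')), if_neg h, add_zero]

lemma stepSize_nonneg (K : ℕ) {γ₀ : ℝ} (h : 0 ≤ γ₀) (t : ℕ) :
    0 ≤ stepSize K γ₀ t := by
  rw [stepSize_eq]; positivity

lemma stepSize_le (K : ℕ) {γ₀ : ℝ} (h : 0 ≤ γ₀) (t : ℕ) :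
    stepSize K γ₀ t ≤ γ₀ := by
  rw [stepSize_eq]
  exact div_le_self h (one_le_pow₀ (by norm_num))

lemma stepSize_epoch {K : ℕ} {γ₀ : ℝ} (l j : ℕ) (hj : j < K) :
    stepSize K γ₀ (l * K + j) = γ₀ / 2 ^ l := by
  have hK : 0 < K := by omega
  rw [stepSize_eq]
  congr 2
  rw [mul_comm, Nat.mul_add_div hK, Nat.div_eq_of_lt hj, add_zero]

/-- Induction along times written as `l * K + j` with `j < K`. -/
lemma epoch_induction {K : ℕ} (hK : 0 < K) {Q : ℕ → ℕ → Prop} (base : Q 0 0)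
    (within : ∀ l j, j + 1 < K → Q l j → Q l (j + 1))
    (across : ∀ l, Q l (K - 1) → Q (l + 1) 0) (t : ℕ) : Q (t / K) (t % K) := by
  have key : ∀ l j, j < K → Q l j := by
    intro l
    induction l with
    | zero =>
      intro j
      induction j with
      | zero => exact fun _ => base
      | succ j ih => exact fun h => within _ _ h (ih (by omega))
    | succ l ihl =>
      intro j
      induction j with
      | zero => exact fun _ => across _ (ihl _ (by omega))
      | succ j ih => exact fun h => within _ _ h (ih (by omega))
  exact key _ _ (Nat.mod_lt _ hK)

/-- The accumulated noise in an eigendirection with eigenvalue `l`. -/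
def noiseAccum (γ : ℕ → ℝ) (l : ℝ) : ℕ → ℝ
  | 0 => 0
  | t + 1 => (1 - γ (t + 1) * l / 2) ^ 2 * noiseAccum γ l t + γ (t + 1) ^ 2 * l ^ 2

lemma noiseAccum_nonneg (γ : ℕ → ℝ) (l : ℝ) (t : ℕ) : 0 ≤ noiseAccum γ l t := by
  induction t with
  | zero => simp [noiseAccum]
  | succ t ih => rw [noiseAccum]; positivity

lemma one_sub_half_sq_le_one {u : ℝ} (h0 : 0 ≤ u) (h1 : u ≤ 2) : (1 - u / 2) ^ 2 ≤ 1 := by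
  nlinarith

lemma noiseAccum_le_sq {K : ℕ} (hK : 0 < K) {γ₀ l : ℝ} (hγ : 0 ≤ γ₀) (hl : 0 ≤ l)
    (hγl : γ₀ * l ≤ 1) (t : ℕ) :
    noiseAccum (stepSize K γ₀) l t ≤ 4 / 3 * K * (γ₀ ^ 2 * l ^ 2) := by
  have hu : ∀ t, (1 - stepSize K γ₀ t * l / 2) ^ 2 ≤ 1 := fun t =>
    one_sub_half_sq_le_one (mul_nonneg (stepSize_nonneg K hγ t) hl)
      (by nlinarith [mul_le_mul_of_nonneg_right (stepSize_le K hγ t) hl])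
  have step : ∀ t, noiseAccum (stepSize K γ₀) l (t + 1) ≤
      noiseAccum (stepSize K γ₀) l t + stepSize K γ₀ (t + 1) ^ 2 * l ^ 2 := fun t => by
    rw [noiseAccum]
    have := mul_le_mul_of_nonneg_right (hu (t + 1)) (noiseAccum_nonneg (stepSize K γ₀) l t)
    linarith
  -- The second summand is the budget of squared stepsizes not yet spent: K - (j + 1) steps of epoch
  -- m, plus K/3 for the geometric series of all later epochs, in units of γ₀²l²/4^m. Time 0 is
  -- charged although no step is taken there.
  have inv := epoch_induction hK
    (Q := fun m j => j < K → noiseAccum (stepSize K γ₀) l (m * K + j) +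
      (4 / 3 * K - (j + 1)) / 4 ^ m * (γ₀ ^ 2 * l ^ 2) ≤ 4 / 3 * K * (γ₀ ^ 2 * l ^ 2))
    (by
      intro _
      simp only [noiseAccum, zero_mul, add_zero, zero_add, pow_zero, div_one, Nat.cast_zero]
      nlinarith [mul_nonneg (sq_nonneg γ₀) (sq_nonneg l)])
    (by
      intro m j hj h _
      have h1 := step (m * K + j)
      rw [add_assoc, stepSize_epoch m (j + 1) hj] at h1
      have h2 : (γ₀ / 2 ^ m) ^ 2 * l ^ 2 = 1 / 4 ^ m * (γ₀ ^ 2 * l ^ 2) := by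
        rw [div_pow, ← pow_mul, mul_comm m 2, pow_mul]; norm_num; ring
      rw [h2] at h1
      have h3 := h (by omega)
      push_cast
      have : (4 / 3 * (K:ℝ) - (j + 1 + 1)) / 4 ^ m = (4 / 3 * K - (j + 1)) / 4 ^ m - 1 / 4 ^ m := by
        ring
      rw [this, sub_mul]
      linarith)
    (by
      intro m h _
      have h1 := step (m * K + (K - 1))
      have e : m * K + (K - 1) + 1 = (m + 1) * K + 0 := by
        rw [add_mul, one_mul, add_zero]; omega
      rw [e, stepSize_epoch (m + 1) 0 hK] at h1
      have h2 : (γ₀ / 2 ^ (m + 1)) ^ 2 * l ^ 2 = 1 / 4 ^ (m + 1) * (γ₀ ^ 2 * l ^ 2) := by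
        rw [div_pow, ← pow_mul, mul_comm (m + 1) 2, pow_mul]; norm_num; ring
      rw [h2] at h1
      have h3 := h (by omega)
      have e2 : ((K - 1 : ℕ) : ℝ) + 1 = K := by exact_mod_cast Nat.sub_add_cancel hK
      rw [e2] at h3
      have : (4 / 3 * (K:ℝ) - K) / 4 ^ m = 4 / 3 * K / 4 ^ (m + 1) := by
        rw [pow_succ]; field_simp; ring
      rw [this] at h3
      push_cast
      have : (4 / 3 * (K:ℝ) - (0 + 1)) / 4 ^ (m + 1) = 4 / 3 * K / 4 ^ (m + 1) - 1 / 4 ^ (m + 1) := by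
        ring
      rw [this, sub_mul]
      linarith)
    t (Nat.mod_lt _ hK)
  have e : t / K * K + t % K = t := by rw [mul_comm]; exact Nat.div_add_mod t K
  simp only [e] at inv
  have hpos : 0 ≤ (4 / 3 * (K:ℝ) - ((t % K : ℕ) + 1)) / 4 ^ (t / K) * (γ₀ ^ 2 * l ^ 2) := by
    have : ((t % K : ℕ) : ℝ) + 1 ≤ K := by exact_mod_cast Nat.mod_lt t hK
    have hK' : (0:ℝ) ≤ K := K.cast_nonneg
    have : 0 ≤ 4 / 3 * (K:ℝ) - ((t % K : ℕ) + 1) := by linarith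
    positivity
  linarith

/-- In an epoch with u = γl, the level 2u is a supersolution of x ↦ (1 - u/2)²x + u², and any excess
over it decays by (1 - u/2)² per step. Noise from earlier epochs is thus forgotten, whatever the
size of γ₀l, down to a remainder of order 1/K. -/
lemma noiseAccum_le_inv {K : ℕ} (hK : 0 < K) {γ₀ l : ℝ} (hγ : 0 ≤ γ₀) (hl : 0 ≤ l)
    (hγl : γ₀ * l ≤ 1) (t : ℕ) :
    noiseAccum (stepSize K γ₀) l t ≤ 4 * (stepSize K γ₀ t * l) + 8 / K := by
  have hK' : (0:ℝ) < K := by exact_mod_cast hK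
  have hu0 : ∀ m : ℕ, 0 ≤ γ₀ / 2 ^ m * l := fun m => by positivity
  have hu1 : ∀ m : ℕ, γ₀ / 2 ^ m * l ≤ 1 := fun m => by
    have : γ₀ / 2 ^ m ≤ γ₀ := div_le_self hγ (one_le_pow₀ (by norm_num))
    nlinarith
  -- Halving u lowers the supersolution from 2u to u, which creates a fresh excess equal to twice
  -- the new u. The term 8/K · 1/(1 + Ku/2) is what is left of all earlier excesses; it grows as u
  -- shrinks but never exceeds 8/K.
  have inv := epoch_induction hK
    (Q := fun m j => j < K → noiseAccum (stepSize K γ₀) l (m * K + j) ≤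
      2 * (γ₀ / 2 ^ m * l) + ((1 - γ₀ / 2 ^ m * l / 2) ^ 2) ^ (j + 1) *
        (2 * (γ₀ / 2 ^ m * l) + 8 / K * (1 / (1 + K * (γ₀ / 2 ^ m * l) / 2))))
    (by
      intro _
      simp only [zero_mul, add_zero, noiseAccum]
      have := hu0 0
      positivity)
    (by
      intro m j hj h _
      have h3 := h (by omega)
      rw [← add_assoc, noiseAccum, add_assoc, stepSize_epoch m (j + 1) hj, ← mul_pow]
      have := hu0 m
      have := hu1 m
      rw [pow_succ _ (j + 1)]
      set u := γ₀ / 2 ^ m * l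
      have h4 := mul_le_mul_of_nonneg_left h3 (sq_nonneg (1 - u / 2))
      have h5 : (1 - u / 2) ^ 2 * (2 * u) + u ^ 2 ≤ 2 * u := by nlinarith [mul_nonneg (sq_nonneg u) (sub_nonneg.2 this)]
      rw [mul_add] at h4
      refine (add_le_add_left h4 _).trans ?_
      nlinarith)
    (by
      intro m h _
      have h3 := h (by omega)
      have e : (m + 1) * K + 0 = m * K + (K - 1) + 1 := by
        rw [add_mul, one_mul, add_zero]; omega
      have e' := stepSize_epoch (γ₀ := γ₀) (m + 1) 0 hK
      rw [e] at e' ⊢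
      rw [noiseAccum, e', ← mul_pow, zero_add, pow_one]
      rw [Nat.sub_add_cancel hK, ← pow_mul, mul_comm 2 K, pow_mul] at h3
      have hv : γ₀ / 2 ^ (m + 1) * l = γ₀ / 2 ^ m * l / 2 := by rw [pow_succ]; field_simp
      rw [hv]
      have hu := hu0 m
      have hu' := hu1 m
      set u := γ₀ / 2 ^ m * l
      have hb := one_sub_pow_mul_le_one (u := u / 2) (by linarith) (by linarith) K
      set p := (1 - u / 2) ^ K
      have hp0 : 0 ≤ p := pow_nonneg (by linarith) _
      have ha : 0 ≤ K * u := by positivity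
      have hp1 : p ≤ 1 / (1 + K * u / 2) := by
        rw [le_div_iff₀ (by positivity)]; linarith [hb]
      have hp2 : p ^ 2 ≤ (1 / (1 + K * u / 2)) ^ 2 := pow_le_pow_left₀ hp0 hp1 2
      have hp3 : p ^ 2 ≤ 1 := by
        refine pow_le_one₀ hp0 (hp1.trans ?_)
        rw [div_le_one (by positivity)]; linarith
      -- After a full epoch the old excess has shrunk by p² ≤ (1 + Ku/2)⁻². What remains of 2u is
      -- paid for by the growth of the remainder term when u is halved.
      have key : p ^ 2 * (2 * u + 8 / K * (1 / (1 + K * u / 2))) ≤ 8 / K * (1 / (1 + K * (u / 2) / 2)) := by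
        have h6 : p ^ 2 * (2 * u) ≤ (1 / (1 + K * u / 2)) ^ 2 * (2 * u) :=
          mul_le_mul_of_nonneg_right hp2 (by linarith)
        have h7 : p ^ 2 * (8 / K * (1 / (1 + K * u / 2))) ≤ 1 * (8 / K * (1 / (1 + K * u / 2))) :=
          mul_le_mul_of_nonneg_right hp3 (by positivity)
        have h8 : 8 / K * (1 / (1 + K * (u / 2) / 2)) - 8 / K * (1 / (1 + K * u / 2)) -
            (1 / (1 + K * u / 2)) ^ 2 * (2 * u) =
            (2 * u) * (K * u / 4) / ((1 + K * u / 4) * (1 + K * u / 2) ^ 2) := by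
          have : 1 + K * u / 2 ≠ 0 := by positivity
          have : 1 + K * u / 4 ≠ 0 := by positivity
          have : (1 + K * (u / 2) / 2) = 1 + K * u / 4 := by ring
          rw [this]
          field_simp
          ring
        have h9 : 0 ≤ (2 * u) * (K * u / 4) / ((1 + K * u / 4) * (1 + K * u / 2) ^ 2) := by positivity
        rw [mul_add]
        linarith
      have h10 := mul_le_mul_of_nonneg_left (h3.trans (add_le_add_right key _)) (sq_nonneg (1 - u / 2 / 2))
      refine (add_le_add_left h10 _).trans ?_
      have h11 : (1 - u / 2 / 2) ^ 2 * u + (u / 2) ^ 2 ≤ u := by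
        nlinarith [mul_nonneg (sq_nonneg u) (sub_nonneg.2 hu')]
      nlinarith)
    t (Nat.mod_lt _ hK)
  have e : t / K * K + t % K = t := by rw [mul_comm]; exact Nat.div_add_mod t K
  simp only [e, ← stepSize_eq K γ₀ t] at inv
  have h0 : 0 ≤ stepSize K γ₀ t * l := mul_nonneg (stepSize_nonneg K hγ t) hl
  have h1 : stepSize K γ₀ t * l ≤ 1 :=
    (mul_le_mul_of_nonneg_right (stepSize_le K hγ t) hl).trans hγl
  set u := stepSize K γ₀ t * l
  have h2 : ((1 - u / 2) ^ 2) ^ (t % K + 1) ≤ 1 :=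
    pow_le_one₀ (sq_nonneg _) (one_sub_half_sq_le_one h0 (by linarith))
  have h3 : 8 / (K:ℝ) * (1 / (1 + K * u / 2)) ≤ 8 / K * 1 := by
    refine mul_le_mul_of_nonneg_left ?_ (by positivity)
    have : 0 ≤ K * u := by positivity
    rw [div_le_one (by positivity)]; linarith
  have h4 := mul_le_mul_of_nonneg_right h2 (show 0 ≤ 2 * u + 8 / (K:ℝ) * (1 / (1 + K * u / 2)) by positivity)
  linarith

/-- Summing the recursion makes y a potential that pays for γ₀ ∑ l y. This gives y₀/γ₀, the right
bound for l ≥ 1/(nγ₀). For smaller l the contraction is negligible over n steps, and each y t is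
simply bounded by y₀ plus the accumulated noise. -/
lemma sum_le_of_constant_step {n : ℕ} (hn : 0 < n) {γ₀ l : ℝ} (hγ : 0 < γ₀) (hl : 0 ≤ l)
    (hγl : γ₀ * l ≤ 1 / 8) {y g : ℕ → ℝ} (hy : ∀ t, 0 ≤ y t) (hg : ∀ t, 0 ≤ g t)
    (hrec : ∀ t < n, y (t + 1) ≤ (1 - γ₀ * l / 2) ^ 2 * y t + γ₀ ^ 2 * l * g t) :
    ∑ t ∈ Finset.range n, l * y t ≤
      32 / 31 * (n * (min l (1 / (n * γ₀)) * y 0) + γ₀ * l * ∑ t ∈ Finset.range n, g t) := by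
  have hn' : (0:ℝ) < n := by exact_mod_cast hn
  have hu0 : 0 ≤ γ₀ * l := by positivity
  have tele : ∀ m ≤ n, 31 / 32 * γ₀ * ∑ t ∈ Finset.range m, l * y t + y m ≤
      y 0 + γ₀ ^ 2 * l * ∑ t ∈ Finset.range m, g t := by
    intro m
    induction m with
    | zero => simp
    | succ m ih =>
      intro hm
      have h1 := ih (by omega)
      have h2 := hrec m (by omega)
      rw [Finset.sum_range_succ, Finset.sum_range_succ]
      -- With u = γ₀l ≤ 1/8, the square is 1 - u + u²/4 and u²/4 ≤ u/32.
      have h3 : (1 - γ₀ * l / 2) ^ 2 ≤ 1 - 31 / 32 * (γ₀ * l) := by nlinarith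
      have h4 := mul_le_mul_of_nonneg_right h3 (hy m)
      nlinarith
  have hG : 0 ≤ ∑ t ∈ Finset.range n, g t := Finset.sum_nonneg fun t _ => hg t
  rcases le_total (1 / (n * γ₀)) l with h | h
  · rw [min_eq_right h]
    have h1 := tele n le_rfl
    have h2 : n * (1 / (n * γ₀) * y 0) = y 0 / γ₀ := by field_simp
    rw [h2]
    have h3 : 31 / 32 * γ₀ * ∑ t ∈ Finset.range n, l * y t ≤
        y 0 + γ₀ ^ 2 * l * ∑ t ∈ Finset.range n, g t := by linarith [hy n]
    have h4 : ∑ t ∈ Finset.range n, l * y t ≤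
        (y 0 + γ₀ ^ 2 * l * ∑ t ∈ Finset.range n, g t) / (31 / 32 * γ₀) := by
      rw [le_div_iff₀ (by positivity)]; linarith
    refine h4.trans (le_of_eq ?_)
    field_simp
  · rw [min_eq_left h]
    set G := ∑ t ∈ Finset.range n, g t
    have hb : ∀ t ∈ Finset.range n, l * y t ≤ l * (y 0 + γ₀ ^ 2 * l * G) := by
      intro t ht
      refine mul_le_mul_of_nonneg_left ?_ hl
      have h1 := tele t (Finset.mem_range.1 ht).le
      have h2 : ∑ s ∈ Finset.range t, g s ≤ G :=
        Finset.sum_le_sum_of_subset_of_nonneg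
          (Finset.range_mono (Finset.mem_range.1 ht).le) fun s _ _ => hg s
      have h3 : 0 ≤ 31 / 32 * γ₀ * ∑ s ∈ Finset.range t, l * y s :=
        mul_nonneg (by positivity) (Finset.sum_nonneg fun s _ => mul_nonneg hl (hy s))
      have h4 := mul_le_mul_of_nonneg_left h2 (show 0 ≤ γ₀ ^ 2 * l by positivity)
      linarith
    have h1 := Finset.sum_le_sum hb
    rw [Finset.sum_const, Finset.card_range, nsmul_eq_mul] at h1
    have h2 : n * γ₀ * l ≤ 1 := by
      rw [le_div_iff₀ (by positivity)] at h; linarith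
    have h3 : (n * γ₀ * l) * (γ₀ * l * G) ≤ 1 * (γ₀ * l * G) :=
      mul_le_mul_of_nonneg_right h2 (by positivity)
    have h4 : 0 ≤ n * (l * y 0) := mul_nonneg hn'.le (mul_nonneg hl (hy 0))
    have h5 : 0 ≤ γ₀ * l * G := by positivity
    nlinarith

/-! ### The coupled system of second moments -/

/-- Second moments `y t i` along eigendirections that contract at the rate of the mean dynamics
and receive noise proportional to the eigenvalue and to the current excess risk. -/
structure MomentSystem (K N : ℕ) (γ₀ α R : ℝ) (lam : ℕ → ℝ) (y : ℕ → ℕ → ℝ) : Prop where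
  two_le : 2 ≤ K
  two_mul_le : 2 * K ≤ N
  le_pow : (K : ℝ) ≤ 8 * 2 ^ (N / K)
  step_pos : 0 < γ₀
  alpha_pos : 0 < α
  noise_nonneg : 0 ≤ R
  lam_nonneg : ∀ i, 0 ≤ lam i
  lam_summable : Summable lam
  step_mul_lam : ∀ i, γ₀ * lam i ≤ 1 / 8
  step_mul_trace : 8 * α * (∑' i, lam i) * γ₀ ≤ 1
  nonneg : ∀ t i, 0 ≤ y t i
  summable_zero : Summable fun i => lam i * y 0 i
  succ_le : ∀ t < N, ∀ i, y (t + 1) i ≤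
    (1 - stepSize K γ₀ (t + 1) * lam i / 2) ^ 2 * y t i +
      stepSize K γ₀ (t + 1) ^ 2 * lam i * (4 * α * (∑' j, lam j * y t j) + R)

namespace MomentSystem

variable {K N : ℕ} {γ₀ α R : ℝ} {lam : ℕ → ℝ} {y : ℕ → ℕ → ℝ}
  (S : MomentSystem K N γ₀ α R lam y)

include S

lemma step_bounds (t i : ℕ) :
    0 ≤ stepSize K γ₀ t * lam i ∧ stepSize K γ₀ t * lam i ≤ 1 / 8 :=
  ⟨mul_nonneg (stepSize_nonneg K S.step_pos.le t) (S.lam_nonneg i),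
    (mul_le_mul_of_nonneg_right (stepSize_le K S.step_pos.le t) (S.lam_nonneg i)).trans
      (S.step_mul_lam i)⟩

lemma risk_nonneg (t : ℕ) : 0 ≤ ∑' j, lam j * y t j :=
  tsum_nonneg fun j => mul_nonneg (S.lam_nonneg j) (S.nonneg t j)

lemma gain_nonneg (t : ℕ) : 0 ≤ 4 * α * (∑' j, lam j * y t j) + R := by
  have := S.risk_nonneg t
  have := S.alpha_pos
  have := S.noise_nonneg
  positivity

/-- Under a constant gain g the noise u²g balances the contraction 31u/32 at the level 32ug/31, and
u never exceeds γ₀λᵢ. This level can therefore be added once and for all. -/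
lemma le_add_of_gain_le {s t : ℕ} (hst : s ≤ t) (htN : t ≤ N) {g : ℝ}
    (hg : ∀ r, s ≤ r → r < t → 4 * α * (∑' j, lam j * y r j) + R ≤ g) (hg0 : 0 ≤ g) (i : ℕ) :
    lam i * y t i ≤ lam i * y s i + 32 / 31 * γ₀ * lam i * g := by
  induction t, hst using Nat.le_induction with
  | base =>
    have := S.step_pos
    have := S.lam_nonneg i
    have : 0 ≤ 32 / 31 * γ₀ * lam i * g := by positivity
    linarith
  | succ t hst ih =>
    have h1 := ih (by omega) (fun r hr hr' => hg r hr (by omega))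
    have h2 := mul_le_mul_of_nonneg_left (S.succ_le t (by omega) i) (S.lam_nonneg i)
    have h3 := hg t hst (by omega)
    obtain ⟨hu0, hu1⟩ := S.step_bounds (t + 1) i
    have hγ := mul_le_mul_of_nonneg_right (stepSize_le K S.step_pos.le (t + 1)) (S.lam_nonneg i)
    have hy : 0 ≤ lam i * y s i := mul_nonneg (S.lam_nonneg i) (S.nonneg s i)
    set u := stepSize K γ₀ (t + 1) * lam i
    have h4 : lam i * ((1 - u / 2) ^ 2 * y t i + stepSize K γ₀ (t + 1) ^ 2 * lam i *
        (4 * α * (∑' j, lam j * y t j) + R)) =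
        (1 - u / 2) ^ 2 * (lam i * y t i) + u ^ 2 * (4 * α * (∑' j, lam j * y t j) + R) := by
      simp only [u]; ring
    rw [h4] at h2
    have h5 := mul_le_mul_of_nonneg_left h1 (sq_nonneg (1 - u / 2))
    have h6 := mul_le_mul_of_nonneg_left h3 (sq_nonneg u)
    have h7 : (1 - u / 2) ^ 2 ≤ 1 - 31 / 32 * u := by nlinarith
    have h8 := mul_le_mul_of_nonneg_right h7
      (show 0 ≤ lam i * y s i + 32 / 31 * γ₀ * lam i * g by
        have := S.step_pos
        have := S.lam_nonneg i
        positivity)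
    have h9 : u * (u * g) ≤ u * (γ₀ * lam i * g) :=
      mul_le_mul_of_nonneg_left (mul_le_mul_of_nonneg_right hγ hg0) hu0
    have h10 := mul_nonneg hu0 hy
    nlinarith

lemma summable {t : ℕ} (ht : t ≤ N) : Summable fun i => lam i * y t i := by
  induction t with
  | zero => exact S.summable_zero
  | succ t ih =>
    refine Summable.of_nonneg_of_le (fun i => mul_nonneg (S.lam_nonneg i) (S.nonneg _ i))
      (fun i => S.le_add_of_gain_le (Nat.le_succ t) ht (g := 4 * α * (∑' j, lam j * y t j) + R)
        (fun r h h' => by rw [show r = t by omega]) (S.gain_nonneg t) i) ?_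
    exact (ih (by omega)).add ((S.lam_summable.mul_left _).mul_right _)

/-- This is where the stepsize condition acts: noise caused by a risk level c feeds back at most
c/2, so risk bounds can be closed by absorption. -/
lemma trace_mul_le {c : ℝ} (hc : 0 ≤ c) : γ₀ * (∑' i, lam i) * (4 * α * c) ≤ c / 2 := by
  have := mul_le_mul_of_nonneg_right S.step_mul_trace hc
  linarith

lemma trace_mul_noise_le : γ₀ * (∑' i, lam i) * R ≤ R / (8 * α) := by
  have h := mul_le_mul_of_nonneg_right S.step_mul_trace S.noise_nonneg
  have := S.alpha_pos
  rw [le_div_iff₀ (by positivity)]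
  linarith

/-- Stability: a small risk at one time bounds the risk at all later times. The induction is strong
because the gain must be bounded at every time between s and t. -/
lemma risk_le_of_le {s t : ℕ} (hst : s ≤ t) (htN : t ≤ N) :
    ∑' j, lam j * y t j ≤ 3 * (∑' j, lam j * y s j) + R / α := by
  induction t using Nat.strong_induction_on with
  | _ t ih =>
    set B := 3 * (∑' j, lam j * y s j) + R / α with hB
    have hα := S.alpha_pos
    have hRα : 0 ≤ R / α := div_nonneg S.noise_nonneg hα.le
    have hs := S.risk_nonneg s
    have hB0 : 0 ≤ B := by positivity
    have hb : ∀ i, lam i * y t i ≤ lam i * y s i + lam i * (32 / 31 * γ₀ * (4 * α * B + R)) := by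
      intro i
      have := S.le_add_of_gain_le hst htN (g := 4 * α * B + R)
        (fun r hr hr' => by
          have := mul_le_mul_of_nonneg_left (ih r hr' hr (by omega)) (show 0 ≤ 4 * α by positivity)
          linarith) (by have := S.noise_nonneg; positivity) i
      linarith
    have h1 : ∑' j, lam j * y t j ≤ ∑' j, lam j * y s j +
        (∑' j, lam j) * (32 / 31 * γ₀ * (4 * α * B + R)) := by
      rw [← tsum_mul_right, ← (S.summable (hst.trans htN)).tsum_add (S.lam_summable.mul_right _)]
      exact (S.summable htN).tsum_le_tsum hb ((S.summable (hst.trans htN)).add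
        (S.lam_summable.mul_right _))
    -- The feedback returns (32/31)(B/2 + R/(8α)). Added to the risk at time s this is below B = 3 ·
    -- risk + R/α, which closes the induction.
    have h2 := S.trace_mul_le hB0
    have h3 := S.trace_mul_noise_le
    have h4 : R / (8 * α) = R / α / 8 := by rw [mul_comm, div_div]
    rw [h4] at h3
    nlinarith

/-- Summing `sum_le_of_constant_step` over directions bounds the total risk by the weighted initial
error, noise, and about half of itself; the last part is absorbed. The horizon is K - 1 because the
stepsize is already halved at step K. -/
lemma sum_risk_le :
    ∑ t ∈ Finset.range (K - 1), ∑' j, lam j * y t j ≤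
      3 * (K - 1 : ℕ) * ((∑' i, min (lam i) (1 / ((K - 1 : ℕ) * γ₀)) * y 0 i) + R / α) := by
  have hK := S.two_le
  have hKN := S.two_mul_le
  have hα := S.alpha_pos
  have hRα : 0 ≤ R / α := div_nonneg S.noise_nonneg hα.le
  set n := K - 1 with hn
  have hn0 : 0 < n := by omega
  have hn' : (0:ℝ) < n := by exact_mod_cast hn0
  set g : ℕ → ℝ := fun t => 4 * α * (∑' j, lam j * y t j) + R
  have hstep : ∀ t < n, stepSize K γ₀ (t + 1) = γ₀ := fun t ht => by
    rw [stepSize_eq, Nat.div_eq_of_lt (by omega)]; simp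
  have hb : ∀ i, ∑ t ∈ Finset.range n, lam i * y t i ≤
      32 / 31 * (n * (min (lam i) (1 / (n * γ₀)) * y 0 i) +
        γ₀ * lam i * ∑ t ∈ Finset.range n, g t) := by
    intro i
    refine sum_le_of_constant_step hn0 S.step_pos (S.lam_nonneg i) (S.step_mul_lam i)
      (fun t => S.nonneg t i) S.gain_nonneg fun t ht => ?_
    have := S.succ_le t (by omega) i
    rwa [hstep t ht] at this
  have hA : Summable fun i => min (lam i) (1 / (n * γ₀)) * y 0 i :=
    Summable.of_nonneg_of_le
      (fun i => mul_nonneg (le_min (S.lam_nonneg i) (by have := S.step_pos; positivity))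
        (S.nonneg 0 i))
      (fun i => mul_le_mul_of_nonneg_right (min_le_left _ _) (S.nonneg 0 i)) S.summable_zero
  have hA0 : 0 ≤ ∑' i, min (lam i) (1 / (n * γ₀)) * y 0 i :=
    tsum_nonneg fun i => mul_nonneg (le_min (S.lam_nonneg i) (by have := S.step_pos; positivity))
        (S.nonneg 0 i)
  set A := ∑' i, min (lam i) (1 / (n * γ₀)) * y 0 i
  have hsum : ∀ t ∈ Finset.range n, Summable fun j => lam j * y t j := fun t ht =>
    S.summable (by have := Finset.mem_range.1 ht; omega)
  have hSg : ∑ t ∈ Finset.range n, g t =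
      4 * α * (∑ t ∈ Finset.range n, ∑' j, lam j * y t j) + n * R := by
    simp only [g, Finset.sum_add_distrib, ← Finset.mul_sum, Finset.sum_const, Finset.card_range,
      nsmul_eq_mul]
  have hS0 : 0 ≤ ∑ t ∈ Finset.range n, ∑' j, lam j * y t j :=
    Finset.sum_nonneg fun t _ => S.risk_nonneg t
  have h1 : ∑ t ∈ Finset.range n, ∑' j, lam j * y t j ≤
      32 / 31 * (n * A + γ₀ * (∑' i, lam i) * ∑ t ∈ Finset.range n, g t) := by
    rw [← Summable.tsum_finsetSum hsum]
    have hs2 : Summable fun i => γ₀ * lam i * ∑ t ∈ Finset.range n, g t :=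
      (S.lam_summable.mul_left _).mul_right _
    refine ((summable_sum hsum).tsum_le_tsum hb
      (((hA.mul_left _).add hs2).mul_left _)).trans (le_of_eq ?_)
    rw [tsum_mul_left, (hA.mul_left _).tsum_add hs2, tsum_mul_left, tsum_mul_right, tsum_mul_left]
  rw [hSg] at h1
  set F := ∑ t ∈ Finset.range n, ∑' j, lam j * y t j
  have h2 := S.trace_mul_le hS0
  have h3 := mul_le_mul_of_nonneg_left S.trace_mul_noise_le hn'.le
  have h4 : R / (8 * α) = R / α / 8 := by rw [mul_comm, div_div]
  rw [h4] at h3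
  have h5 : 0 ≤ n * A := by positivity
  have h6 : 0 ≤ n * (R / α) := by positivity
  nlinarith

/-- Noise of steps 1, …, K - 1 is only known in total, since the risk may be large there, but the
next K steps, with stepsize γ₀/2, damp it to order 1/K². Later noise has gain at most g and is
governed by `noiseAccum`. -/
lemma coord_le {g : ℝ} (hg0 : 0 ≤ g)
    (hg : ∀ r, K - 1 ≤ r → r < N → 4 * α * (∑' j, lam j * y r j) + R ≤ g) (i : ℕ) :
    lam i * y N i ≤ lam i * ((∏ t ∈ Finset.range N, (1 - stepSize K γ₀ (t + 1) * lam i / 2) ^ 2) * y 0 i) +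
      (16 * (∑ t ∈ Finset.range (K - 1), (4 * α * (∑' j, lam j * y t j) + R)) + 12 * K * g) *
        min (γ₀ ^ 2 * lam i ^ 2) (1 / (K:ℝ) ^ 2) := by
  have hK := S.two_le
  have hKN := S.two_mul_le
  have hK' : (0:ℝ) < K := by exact_mod_cast (show 0 < K by omega)
  have hl := S.lam_nonneg i
  have hγ := S.step_pos
  have hγl := S.step_mul_lam i
  set l := lam i
  set n := K - 1 with hn
  have hG0 : 0 ≤ ∑ t ∈ Finset.range n, (4 * α * (∑' j, lam j * y t j) + R) :=
    Finset.sum_nonneg fun t _ => S.gain_nonneg t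
  have first : ∀ m ≤ n, l * y m i ≤
      l * ((∏ t ∈ Finset.range m, (1 - stepSize K γ₀ (t + 1) * l / 2) ^ 2) * y 0 i) +
      γ₀ ^ 2 * l ^ 2 * ∑ t ∈ Finset.range m, (4 * α * (∑' j, lam j * y t j) + R) := by
    intro m
    induction m with
    | zero => simp
    | succ m ih =>
      intro hm
      have h1 := ih (by omega)
      have h2 := mul_le_mul_of_nonneg_left (S.succ_le m (by omega) i) hl
      obtain ⟨hu0, hu1⟩ := S.step_bounds (m + 1) i
      have h3 : stepSize K γ₀ (m + 1) = γ₀ := by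
        rw [stepSize_eq, Nat.div_eq_of_lt (by omega)]; simp
      rw [Finset.prod_range_succ, Finset.sum_range_succ]
      rw [h3] at h2 hu0 hu1 ⊢
      set P := ∏ t ∈ Finset.range m, (1 - stepSize K γ₀ (t + 1) * l / 2) ^ 2
      have hs : 0 ≤ ∑ t ∈ Finset.range m, (4 * α * (∑' j, lam j * y t j) + R) :=
        Finset.sum_nonneg fun t _ => S.gain_nonneg t
      set Q := ∑ t ∈ Finset.range m, (4 * α * (∑' j, lam j * y t j) + R)
      have h4 := mul_le_mul_of_nonneg_left h1 (sq_nonneg (1 - γ₀ * l / 2))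
      have h5 := mul_le_mul_of_nonneg_right (one_sub_half_sq_le_one hu0 (by linarith))
        (show 0 ≤ γ₀ ^ 2 * l ^ 2 * Q by positivity)
      change l * y (m + 1) i ≤ l * ((1 - γ₀ * l / 2) ^ 2 * y m i + γ₀ ^ 2 * l * (4 * α * (∑' j, lam j * y m j) + R)) at h2
      have h6 : (1 - γ₀ * l / 2) ^ 2 * (γ₀ ^ 2 * l ^ 2 * Q) ≤ γ₀ ^ 2 * l ^ 2 * Q := by
        simpa only [one_mul] using h5
      linarith
  -- `noiseAccum` is started at time 0 rather than n. The surplus is nonnegative, so the bound only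
  -- weakens.
  have second : ∀ m, n ≤ m → m ≤ N → l * y m i ≤
      (∏ t ∈ Finset.Ico n m, (1 - stepSize K γ₀ (t + 1) * l / 2) ^ 2) * (l * y n i) +
      g * noiseAccum (stepSize K γ₀) l m := by
    intro m hm
    induction m, hm using Nat.le_induction with
    | base =>
      intro _
      have := mul_nonneg hg0 (noiseAccum_nonneg (stepSize K γ₀) l n)
      simp only [Finset.Ico_self, Finset.prod_empty, one_mul]
      linarith
    | succ m hm ih =>
      intro hmN
      have h1 := ih (by omega)
      have h2 := mul_le_mul_of_nonneg_left (S.succ_le m (by omega) i) hl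
      have h3 := hg m hm (by omega)
      rw [Finset.prod_Ico_succ_top hm, noiseAccum]
      change l * y (m + 1) i ≤ l * ((1 - stepSize K γ₀ (m + 1) * l / 2) ^ 2 * y m i + stepSize K γ₀ (m + 1) ^ 2 * l * (4 * α * (∑' j, lam j * y m j) + R)) at h2
      have h4 := mul_le_mul_of_nonneg_left h1 (sq_nonneg (1 - stepSize K γ₀ (m + 1) * l / 2))
      have h5 := mul_le_mul_of_nonneg_left h3 (show 0 ≤ stepSize K γ₀ (m + 1) ^ 2 * l ^ 2 by positivity)
      linarith
  have h1 := first n le_rfl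
  have h2 := second N (by omega) le_rfl
  set G := ∑ t ∈ Finset.range n, (4 * α * (∑' j, lam j * y t j) + R)
  have hP0 : 0 ≤ ∏ t ∈ Finset.Ico n N, (1 - stepSize K γ₀ (t + 1) * l / 2) ^ 2 :=
    Finset.prod_nonneg fun t _ => sq_nonneg _
  have hfac1 : ∀ t, (1 - stepSize K γ₀ (t + 1) * l / 2) ^ 2 ≤ 1 := fun t =>
    one_sub_half_sq_le_one (S.step_bounds (t + 1) i).1 (by linarith [(S.step_bounds (t + 1) i).2])
  have hP1 : ∏ t ∈ Finset.Ico n N, (1 - stepSize K γ₀ (t + 1) * l / 2) ^ 2 ≤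
      ((1 - γ₀ * l / 4) ^ K) ^ 2 := by
    -- Indices n to n + K - 1 are the steps K to 2K - 1, exactly the second epoch; all later factors
    -- are at most 1.
    rw [← Finset.prod_Ico_consecutive _ (show n ≤ n + K by omega) (show n + K ≤ N by omega)]
    have e1 : ∏ t ∈ Finset.Ico n (n + K), (1 - stepSize K γ₀ (t + 1) * l / 2) ^ 2 =
        ((1 - γ₀ * l / 4) ^ K) ^ 2 := by
      have hc : ∀ t ∈ Finset.Ico n (n + K),
          (1 - stepSize K γ₀ (t + 1) * l / 2) ^ 2 = (1 - γ₀ * l / 4) ^ 2 := ?_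
      · rw [Finset.prod_congr rfl hc, Finset.prod_const,
          Nat.card_Ico, Nat.add_sub_cancel_left, ← pow_mul, ← pow_mul, mul_comm 2 K]
      intro t ht
      rw [Finset.mem_Ico] at ht
      have : t + 1 = 1 * K + (t + 1 - K) := by omega
      rw [this, stepSize_epoch 1 _ (by omega)]
      ring
    rw [e1]
    exact mul_le_of_le_one_right (by positivity)
      (Finset.prod_le_one (fun t _ => sq_nonneg _) fun t _ => hfac1 t)
  have hPone : ∏ t ∈ Finset.Ico n N, (1 - stepSize K γ₀ (t + 1) * l / 2) ^ 2 ≤ 1 :=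
    Finset.prod_le_one (fun t _ => sq_nonneg _) fun t _ => hfac1 t
  have hu0 : 0 ≤ γ₀ * l := by positivity
  have hmin : (∏ t ∈ Finset.Ico n N, (1 - stepSize K γ₀ (t + 1) * l / 2) ^ 2) * (γ₀ ^ 2 * l ^ 2) ≤
      16 * min (γ₀ ^ 2 * l ^ 2) (1 / (K:ℝ) ^ 2) := by
    rw [mul_min_of_nonneg _ _ (by norm_num)]
    refine le_min ?_ ?_
    · have := mul_le_mul_of_nonneg_right hPone (show 0 ≤ γ₀ ^ 2 * l ^ 2 by positivity)
      have : 0 ≤ γ₀ ^ 2 * l ^ 2 := by positivity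
      linarith
    · refine (mul_le_mul_of_nonneg_right hP1 (by positivity)).trans ?_
      have hb := one_sub_pow_mul_le_one (u := γ₀ * l / 4) (by linarith) (by linarith) K
      have hp0 : 0 ≤ (1 - γ₀ * l / 4) ^ K := pow_nonneg (by linarith) _
      have h3 : (1 - γ₀ * l / 4) ^ K * (γ₀ * l) ≤ 4 / K := by
        rw [le_div_iff₀ hK']; nlinarith
      have h4 := pow_le_pow_left₀ (mul_nonneg hp0 hu0) h3 2
      calc _ = ((1 - γ₀ * l / 4) ^ K * (γ₀ * l)) ^ 2 := by ring
        _ ≤ (4 / K) ^ 2 := h4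
        _ = 16 * (1 / (K:ℝ) ^ 2) := by rw [div_pow]; ring
  have hnoise : noiseAccum (stepSize K γ₀) l N ≤ 12 * K * min (γ₀ ^ 2 * l ^ 2) (1 / (K:ℝ) ^ 2) := by
    rw [mul_min_of_nonneg _ _ (by positivity)]
    refine le_min ?_ ?_
    · have := noiseAccum_le_sq (show 0 < K by omega) hγ.le hl (by linarith) N
      have : 0 ≤ (K:ℝ) * (γ₀ ^ 2 * l ^ 2) := by positivity
      nlinarith
    · refine (noiseAccum_le_inv (show 0 < K by omega) hγ.le hl (by linarith) N).trans ?_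
      -- The final stepsize is γ₀/2^(N/K); γ₀l ≤ 1/8 and K ≤ 8 · 2^(N/K) make its product with l at
      -- most 1/K. Hence 4/K + 8/K = 12/K.
      have h3 : stepSize K γ₀ N * l ≤ 1 / K := by
        rw [stepSize_eq, div_mul_eq_mul_div, div_le_div_iff₀ (by positivity) hK', one_mul]
        have := mul_le_mul hγl S.le_pow hK'.le (by norm_num)
        linarith
      have : 12 * (K:ℝ) * (1 / K ^ 2) = 12 * (1 / K) := by field_simp
      rw [this]
      have : 8 / (K:ℝ) = 8 * (1 / K) := by ring
      linarith
  have e : ∏ t ∈ Finset.range N, (1 - stepSize K γ₀ (t + 1) * l / 2) ^ 2 =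
      (∏ t ∈ Finset.range n, (1 - stepSize K γ₀ (t + 1) * l / 2) ^ 2) *
      ∏ t ∈ Finset.Ico n N, (1 - stepSize K γ₀ (t + 1) * l / 2) ^ 2 := by
    rw [Finset.prod_range_mul_prod_Ico _ (by omega)]
  rw [e]
  have h3 := mul_le_mul_of_nonneg_left h1 hP0
  have h4 := mul_le_mul_of_nonneg_right hmin hG0
  have h5 := mul_le_mul_of_nonneg_left hnoise hg0
  linarith

theorem risk_le :
    ∑' i, lam i * y N i ≤
      ∑' i, lam i * ((∏ t ∈ Finset.range N, (1 - stepSize K γ₀ (t + 1) * lam i / 2) ^ 2) * y 0 i) +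
      700 * (α * (∑' i, min (lam i) (1 / ((K - 1 : ℕ) * γ₀)) * y 0 i) + R) *
        (K * ∑' i, min (γ₀ ^ 2 * lam i ^ 2) (1 / (K:ℝ) ^ 2)) := by
  have hK := S.two_le
  have hKN := S.two_mul_le
  have hα := S.alpha_pos
  have hγ := S.step_pos
  have hR := S.noise_nonneg
  have hS := S.sum_risk_le
  have hn0 : 0 < K - 1 := by omega
  have hn' : (0:ℝ) < (K - 1 : ℕ) := by exact_mod_cast hn0
  have hnK : ((K - 1 : ℕ) : ℝ) ≤ K := by exact_mod_cast Nat.sub_le K 1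
  have hA0 : 0 ≤ ∑' i, min (lam i) (1 / ((K - 1 : ℕ) * γ₀)) * y 0 i :=
    tsum_nonneg fun i => mul_nonneg (le_min (S.lam_nonneg i) (by positivity)) (S.nonneg 0 i)
  set A := ∑' i, min (lam i) (1 / ((K - 1 : ℕ) * γ₀)) * y 0 i
  -- Some term is at most the average.
  obtain ⟨t₀, ht₀, hmin⟩ : ∃ t ∈ Finset.range (K - 1), ∑' j, lam j * y t j ≤ 3 * (A + R / α) := by
    refine Finset.exists_le_of_sum_le ⟨0, Finset.mem_range.2 hn0⟩ ?_
    rw [Finset.sum_const, Finset.card_range, nsmul_eq_mul]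
    linarith
  rw [Finset.mem_range] at ht₀
  have hαR : α * (R / α) = R := by field_simp
  -- Stability from t₀ gives risk at most 9A + 10R/α, hence gain at most 36αA + 41R.
  have hg : ∀ r, K - 1 ≤ r → r < N → 4 * α * (∑' j, lam j * y r j) + R ≤ 41 * (α * A + R) := by
    intro r hr hrN
    have h1 := S.risk_le_of_le (show t₀ ≤ r by omega) hrN.le
    have h2 : ∑' j, lam j * y r j ≤ 9 * A + 10 * (R / α) := by linarith
    have h3 := mul_le_mul_of_nonneg_left h2 hα.le
    have h4 : 0 ≤ α * A := by positivity
    nlinarith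
  have hG : ∑ t ∈ Finset.range (K - 1), (4 * α * (∑' j, lam j * y t j) + R) ≤
      13 * K * (α * A + R) := by
    rw [Finset.sum_add_distrib, ← Finset.mul_sum, Finset.sum_const, Finset.card_range, nsmul_eq_mul]
    have h1 := mul_le_mul_of_nonneg_left hS hα.le
    have h2 : 0 ≤ α * A := by positivity
    have h3 : α * (3 * (K - 1 : ℕ) * (A + R / α)) = 3 * (K - 1 : ℕ) * (α * A + R) := by
      field_simp
    rw [h3] at h1
    have h4 := mul_le_mul_of_nonneg_right hnK (show 0 ≤ α * A + R by linarith)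
    have h5 : 0 ≤ ((K - 1 : ℕ):ℝ) * (α * A) := by positivity
    nlinarith
  have hm0 : ∀ i, 0 ≤ min (γ₀ ^ 2 * lam i ^ 2) (1 / (K:ℝ) ^ 2) := fun i =>
    le_min (by positivity) (by positivity)
  have hb : ∀ i, lam i * y N i ≤
      lam i * ((∏ t ∈ Finset.range N, (1 - stepSize K γ₀ (t + 1) * lam i / 2) ^ 2) * y 0 i) +
      700 * (α * A + R) * K * min (γ₀ ^ 2 * lam i ^ 2) (1 / (K:ℝ) ^ 2) := by
    intro i
    refine (S.coord_le (g := 41 * (α * A + R)) (by positivity) hg i).trans ?_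
    refine add_le_add_right (mul_le_mul_of_nonneg_right ?_ (hm0 i)) _
    -- 16 · 13 + 12 · 41 = 700.
    linarith
  have hs1 : Summable fun i => lam i *
      ((∏ t ∈ Finset.range N, (1 - stepSize K γ₀ (t + 1) * lam i / 2) ^ 2) * y 0 i) := by
    refine Summable.of_nonneg_of_le (fun i => mul_nonneg (S.lam_nonneg i)
      (mul_nonneg (Finset.prod_nonneg fun t _ => sq_nonneg _) (S.nonneg 0 i))) (fun i => ?_)
      S.summable_zero
    refine mul_le_mul_of_nonneg_left (mul_le_of_le_one_left (S.nonneg 0 i) ?_) (S.lam_nonneg i)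
    exact Finset.prod_le_one (fun t _ => sq_nonneg _) fun t _ =>
      one_sub_half_sq_le_one (S.step_bounds (t + 1) i).1 (by linarith [(S.step_bounds (t + 1) i).2])
  have hs2 : Summable fun i => min (γ₀ ^ 2 * lam i ^ 2) (1 / (K:ℝ) ^ 2) := by
    refine Summable.of_nonneg_of_le hm0 (fun i => (min_le_left _ _).trans ?_)
      (S.lam_summable.mul_left γ₀)
    have := S.step_mul_lam i
    have h0 : 0 ≤ γ₀ * lam i := mul_nonneg hγ.le (S.lam_nonneg i)
    nlinarith
  refine ((S.summable le_rfl).tsum_le_tsum hb (hs1.add (hs2.mul_left _))).trans (le_of_eq ?_)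
  rw [hs1.tsum_add (hs2.mul_left _), tsum_mul_left]
  ring

end MomentSystem

/-! ### Eigendecompositions, seminorms and the trace -/

section Operators

variable {E : Type*} [NormedAddCommGroup E] [InnerProductSpace ℝ E]

lemma outer_apply (x w : E) : outer x w = ⟪x, w⟫ • x := by
  simp [outer, InnerProductSpace.rankOne_apply]

lemma norm_outer (x : E) : ‖outer x‖ = ‖x‖ ^ 2 := by
  rw [outer, InnerProductSpace.norm_rankOne, sq]

lemma continuous_outer : Continuous (outer : E → E →L[ℝ] E) := by
  have h : Continuous fun p : (E →L⋆[ℝ] E →L[ℝ] E) × E => p.1 p.2 :=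
    continuous_fst.clm_apply continuous_snd
  exact h.comp ((InnerProductSpace.rankOne ℝ).continuous.prodMk continuous_id)

lemma inner_le_of_le {A B : E →L[ℝ] E} (h : A ≤ B) (u : E) : ⟪u, A u⟫ ≤ ⟪u, B u⟫ := by
  have := ((ContinuousLinearMap.le_def A B).1 h).inner_nonneg_right u
  rw [sub_apply, inner_sub_right] at this
  linarith

variable {H : E →L[ℝ] E} {lam : ℕ → ℝ} {v : ℕ → E}

namespace IsEigendecomposition

variable (hE : IsEigendecomposition H lam v)
include hE

lemma hasSum_inner (u w : E) :
    HasSum (fun i => lam i * (⟪v i, u⟫ * ⟪v i, w⟫)) ⟪u, H w⟫ := by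
  have h := (hE.hasSum w).mapL (innerSL ℝ u)
  simp only [innerSL_apply_apply] at h
  refine h.congr_fun fun i => ?_
  rw [outer_apply, inner_smul_right, inner_smul_right, real_inner_comm (v i) u]
  ring

lemma hasSum_sqNorm (w : E) : HasSum (fun i => lam i * ⟪v i, w⟫ ^ 2) (sqNorm H w) := by
  simpa only [sq, sqNorm] using hE.hasSum_inner w w

lemma inner_apply_comm (u w : E) : ⟪u, H w⟫ = ⟪w, H u⟫ := by
  refine (hE.hasSum_inner u w).unique ?_
  simpa only [mul_comm ⟪v _, u⟫] using hE.hasSum_inner w u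

lemma sqNorm_nonneg (w : E) : 0 ≤ sqNorm H w :=
  (hE.hasSum_sqNorm w).nonneg fun i => mul_nonneg (hE.nonneg i) (sq_nonneg _)

lemma apply_self (i : ℕ) : H (v i) = lam i • v i := by
  refine (hE.hasSum (v i)).unique ?_
  have h : lam i • v i = lam i • outer (v i) (v i) := by
    rw [outer_apply]
    rcases hE.norm_eq i with h | ⟨h, h'⟩
    · rw [real_inner_self_eq_norm_sq, h]; simp
    · simp [h]
  rw [h]
  refine hasSum_single i fun j hj => ?_
  rw [outer_apply, hE.orthogonal j i hj]
  simp

lemma inner_apply (i : ℕ) (w : E) : ⟪v i, H w⟫ = lam i * ⟪v i, w⟫ := by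
  rw [hE.inner_apply_comm, hE.apply_self, inner_smul_right, real_inner_comm]

lemma inner_contraction (γ : ℕ → ℝ) (N i : ℕ) (w : E) :
    ⟪v i, contraction γ H N w⟫ =
      (∏ t ∈ Finset.range N, (1 - γ (t + 1) * lam i / 2)) * ⟪v i, w⟫ := by
  induction N generalizing w with
  | zero => simp [contraction]
  | succ N ih =>
    have h : contraction γ H (N + 1) w = contraction γ H N ((1 - (γ (N + 1) / 2) • H) w) := by
      simp [contraction, List.range_succ]
    rw [h, ih, Finset.prod_range_succ]
    simp only [sub_apply, one_apply_eq_self,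
      smul_apply, inner_sub_right, inner_smul_right, hE.inner_apply]
    ring

lemma norm_le_one (i : ℕ) : ‖v i‖ ≤ 1 := by
  rcases hE.norm_eq i with h | ⟨_, h⟩ <;> simp [h]

/-- Treats unit eigenvectors and the zero padding uniformly, so later arguments need no case split.
-/
lemma lam_mul_norm_sq (i : ℕ) : lam i * ‖v i‖ ^ 2 = lam i := by
  rcases hE.norm_eq i with h | ⟨h, h'⟩ <;> simp [h]

lemma sqNorm_tailOp (hs : Summable lam) [CompleteSpace E] (k : ℕ) (w : E) :
    sqNorm (tailOp lam v k) w = ∑' i, lam (k + i) * ⟪v (k + i), w⟫ ^ 2 := by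
  have hs' : Summable fun i => lam (k + i) := by
    simpa only [add_comm k] using (summable_nat_add_iff k).2 hs
  have h1 : Summable fun i => lam (k + i) • outer (v (k + i)) := by
    refine Summable.of_norm_bounded hs' fun i => ?_
    rw [norm_smul, norm_outer, Real.norm_eq_abs, abs_of_nonneg (hE.nonneg _), hE.lam_mul_norm_sq]
  have h2 := (h1.hasSum.mapL (ContinuousLinearMap.apply ℝ E w)).mapL (innerSL ℝ w)
  rw [sqNorm, tailOp]
  refine Eq.symm (HasSum.tsum_eq ?_)
  refine h2.congr_fun fun i => ?_
  simp only [ContinuousLinearMap.apply_apply, smul_apply, innerSL_apply_apply,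
    outer_apply, inner_smul_right]
  rw [real_inner_comm (v (k + i)) w]
  ring

end IsEigendecomposition

lemma sqNorm_headProj (v : ℕ → E) (k : ℕ) (w : E) :
    sqNorm (headProj v k) w = ∑ i ∈ Finset.range k, ⟪v i, w⟫ ^ 2 := by
  rw [sqNorm, headProj, sum_apply, inner_sum]
  refine Finset.sum_congr rfl fun i _ => ?_
  rw [outer_apply, inner_smul_right, real_inner_comm (v i) w, sq]

lemma sqNorm_smul_add (c : ℝ) (A B : E →L[ℝ] E) (w : E) :
    sqNorm (c • A + B) w = c * sqNorm A w + sqNorm B w := by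
  simp [sqNorm, inner_add_right, inner_smul_right]

variable [CompleteSpace E]

lemma exists_hilbertBasis_choose :
    ∃ b : HilbertBasis (exists_hilbertBasis ℝ E).choose ℝ E, ⇑b = ((↑) : _ → E) :=
  (exists_hilbertBasis ℝ E).choose_spec

/-- Parseval in the basis that defines the trace. -/
lemma trace_mul_outer (A : E →L[ℝ] E) (u : E) : trace (A * outer u) = ⟪u, A u⟫ := by
  obtain ⟨b, hb⟩ := exists_hilbertBasis_choose (E := E)
  have h := b.hasSum_inner_mul_inner u (A u)
  rw [trace, ← h.tsum_eq, hb]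
  refine tsum_congr fun i => ?_
  rw [mul_apply_eq_comp, outer_apply, map_smul, inner_smul_right]

lemma hasSum_inner_sq (u : E) :
    HasSum (fun b : (exists_hilbertBasis ℝ E).choose => ⟪u, (b : E)⟫ ^ 2) (‖u‖ ^ 2) := by
  obtain ⟨b, hb⟩ := exists_hilbertBasis_choose (E := E)
  have h := b.hasSum_inner_mul_inner u u
  rw [hb, real_inner_self_eq_norm_sq] at h
  refine h.congr_fun fun i => ?_
  rw [real_inner_comm u, sq]

end Operators

/-! ### Moments of the features -/

section Moments

lemma integrable_norm_pow_four {E : Type*} [NormedAddCommGroup E] [MeasurableSpace E]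
    {D : Measure (E × ℝ)} (hx : MemLp (fun p : E × ℝ => p.1) 4 D) :
    Integrable (fun p : E × ℝ => ‖p.1‖ ^ 4) D := by
  simpa using hx.integrable_norm_pow (p := 4) (by norm_num)

lemma integrable_norm_sq {E : Type*} [NormedAddCommGroup E] [MeasurableSpace E]
    {D : Measure (E × ℝ)} [IsProbabilityMeasure D] (hx : MemLp (fun p : E × ℝ => p.1) 4 D) :
    Integrable (fun p : E × ℝ => ‖p.1‖ ^ 2) D :=
  (hx.mono_exponent (q := 4) (p := 2) (by norm_num)).integrable_norm_pow (by norm_num)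

variable {E : Type*} [NormedAddCommGroup E] [InnerProductSpace ℝ E] [CompleteSpace E]
  [SecondCountableTopology E] [MeasurableSpace E] [BorelSpace E]
  {D : Measure (E × ℝ)} [IsProbabilityMeasure D]

lemma relu_sub_sq_le (a b : ℝ) : (relu a - relu b) ^ 2 ≤ (a - b) ^ 2 := by
  refine sq_le_sq.2 ?_
  simpa [relu] using abs_max_sub_max_le_abs a b 0

lemma abs_relu_le (a : ℝ) : |relu a| ≤ |a| := by
  have h := sq_le_sq.1 (relu_sub_sq_le a 0)
  simpa [relu] using h

variable (hx : MemLp (fun p : E × ℝ => p.1) 4 D)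
include hx

lemma integrable_outer : Integrable (fun p : E × ℝ => outer p.1) D := by
  refine (integrable_norm_sq hx).mono' (continuous_outer.comp_aestronglyMeasurable hx.1) ?_
  exact ae_of_all _ fun p => (norm_outer p.1).le

lemma integrable_inner_mul_inner (u w : E) :
    Integrable (fun p : E × ℝ => ⟪p.1, u⟫ * ⟪p.1, w⟫) D := by
  refine ((integrable_norm_sq hx).mul_const (‖u‖ * ‖w‖)).mono' (by fun_prop) ?_
  refine ae_of_all _ fun p => ?_
  rw [norm_mul]
  have h1 := norm_inner_le_norm (𝕜 := ℝ) p.1 u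
  have h2 := norm_inner_le_norm (𝕜 := ℝ) p.1 w
  calc _ ≤ (‖p.1‖ * ‖u‖) * (‖p.1‖ * ‖w‖) := by gcongr
    _ = _ := by ring

lemma integrable_inner_sq_mul_inner_sq (u w : E) :
    Integrable (fun p : E × ℝ => ⟪p.1, u⟫ ^ 2 * ⟪p.1, w⟫ ^ 2) D := by
  refine ((integrable_norm_pow_four hx).mul_const (‖u‖ ^ 2 * ‖w‖ ^ 2)).mono' (by fun_prop) ?_
  refine ae_of_all _ fun p => ?_
  rw [norm_mul, norm_pow, norm_pow]
  have h1 := norm_inner_le_norm (𝕜 := ℝ) p.1 u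
  have h2 := norm_inner_le_norm (𝕜 := ℝ) p.1 w
  calc _ ≤ (‖p.1‖ * ‖u‖) ^ 2 * (‖p.1‖ * ‖w‖) ^ 2 := by gcongr
    _ = _ := by ring

lemma inner_integral_outer {s : Set (E × ℝ)} (u w : E) :
    ⟪u, (∫ p in s, outer p.1 ∂D) w⟫ = ∫ p in s, ⟪p.1, u⟫ * ⟪p.1, w⟫ ∂D := by
  have hi := (integrable_outer hx).integrableOn (s := s)
  rw [ContinuousLinearMap.integral_apply hi, ← integral_inner]
  · refine integral_congr_ae (ae_of_all _ fun p => ?_)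
    simp only [outer_apply, inner_smul_right]
    rw [real_inner_comm p.1 u, mul_comm]
  · exact hi.apply_continuousLinearMap w

lemma inner_cov (u w : E) : ⟪u, cov D w⟫ = ∫ p, ⟪p.1, u⟫ * ⟪p.1, w⟫ ∂D := by
  have := inner_integral_outer hx (s := Set.univ) u w
  simpa only [Measure.restrict_univ, cov] using this

lemma sqNorm_cov (u : E) : sqNorm (cov D) u = ∫ p, ⟪p.1, u⟫ ^ 2 ∂D := by
  simp only [sqNorm, inner_cov hx, sq]

lemma sqNorm_cov_nonneg (u : E) : 0 ≤ sqNorm (cov D) u := by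
  rw [sqNorm_cov hx]; positivity

/-- Each λᵢ is spread over the trace basis by Parseval, and the eigenexpansion of H dominates the
partial sum at every basis vector. Summability of the trace series itself follows from Bessel and
E‖x‖² < ∞. The inequality suffices, since the trace only enters through an upper bound on the
stepsize. -/
lemma sum_le_trace_cov {lam : ℕ → ℝ} {v : ℕ → E} (hE : IsEigendecomposition (cov D) lam v)
    (s : Finset ℕ) : ∑ i ∈ s, lam i ≤ trace (cov D) := by
  have hb0 : ∀ b : E, 0 ≤ ⟪b, cov D b⟫ := fun b => sqNorm_cov_nonneg hx b
  have hsum : Summable fun b : (exists_hilbertBasis ℝ E).choose => ⟪(b : E), cov D b⟫ := by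
    refine summable_of_sum_le (c := ∫ p, ‖p.1‖ ^ 2 ∂D) (fun b => hb0 b) fun F => ?_
    simp only [inner_cov hx]
    rw [← integral_finsetSum _ fun b _ => integrable_inner_mul_inner hx _ _]
    refine integral_mono (integrable_finsetSum _ fun b _ => integrable_inner_mul_inner hx _ _)
      (integrable_norm_sq hx) fun p => ?_
    have h := hasSum_inner_sq p.1
    simp only [← sq]
    exact sum_le_hasSum F (fun b _ => sq_nonneg _) h
  have h1 : HasSum (fun b : (exists_hilbertBasis ℝ E).choose =>
      ∑ i ∈ s, lam i * ⟪v i, (b : E)⟫ ^ 2) (∑ i ∈ s, lam i) := by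
    have := hasSum_sum (s := s) (fun i _ => (hasSum_inner_sq (v i)).mul_left (lam i))
    simpa only [hE.lam_mul_norm_sq] using this
  rw [trace, ← h1.tsum_eq]
  refine h1.summable.tsum_le_tsum (fun b => ?_) hsum
  exact sum_le_hasSum s (fun i _ => mul_nonneg (hE.nonneg i) (sq_nonneg _))
    (hE.hasSum_sqNorm (b : E))

lemma summable_lam {lam : ℕ → ℝ} {v : ℕ → E} (hE : IsEigendecomposition (cov D) lam v) :
    Summable lam :=
  summable_of_sum_le hE.nonneg (sum_le_trace_cov hx hE)

lemma tsum_lam_le_trace {lam : ℕ → ℝ} {v : ℕ → E} (hE : IsEigendecomposition (cov D) lam v) :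
    ∑' i, lam i ≤ trace (cov D) :=
  (summable_lam hx hE).tsum_le_of_sum_le (sum_le_trace_cov hx hE)

/-- With both sectors taken along w, symmetry says that the half-spaces xᵀw > 0 and xᵀw < 0
contribute equally to E[(xᵀw)(xᵀu)]; the ReLU keeps the first. -/
lemma integral_relu_mul_inner (hsym : SymmetricFeatures D) (w u : E) :
    ∫ p, relu ⟪p.1, w⟫ * ⟪p.1, u⟫ ∂D = ⟪w, cov D u⟫ / 2 := by
  have hpos : MeasurableSet {p : E × ℝ | 0 < ⟪p.1, w⟫} :=
    measurableSet_lt measurable_const (by fun_prop)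
  have hneg : MeasurableSet {p : E × ℝ | ⟪p.1, w⟫ < 0} :=
    measurableSet_lt (by fun_prop) measurable_const
  have hs := congrArg (fun A : E →L[ℝ] E => ⟪w, A u⟫) (hsym.second w w)
  simp only [and_self, inner_integral_outer hx] at hs
  rw [← integral_indicator hpos, ← integral_indicator hneg] at hs
  have hi := integrable_inner_mul_inner hx w u
  have h1 : ∀ p : E × ℝ, ⟪p.1, w⟫ * ⟪p.1, u⟫ =
      {p : E × ℝ | 0 < ⟪p.1, w⟫}.indicator (fun p => ⟪p.1, w⟫ * ⟪p.1, u⟫) p +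
      {p : E × ℝ | ⟪p.1, w⟫ < 0}.indicator (fun p => ⟪p.1, w⟫ * ⟪p.1, u⟫) p := by
    intro p
    simp only [Set.indicator_apply, Set.mem_ofPred_eq]
    rcases lt_trichotomy ⟪p.1, w⟫ 0 with h | h | h
    · simp [h, h.le.not_gt]
    · simp [h]
    · simp [h, h.le.not_gt]
  have h2 : ∀ p : E × ℝ, relu ⟪p.1, w⟫ * ⟪p.1, u⟫ =
      {p : E × ℝ | 0 < ⟪p.1, w⟫}.indicator (fun p => ⟪p.1, w⟫ * ⟪p.1, u⟫) p := by
    intro p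
    simp only [Set.indicator_apply, Set.mem_ofPred_eq, relu]
    split_ifs with h
    · rw [max_eq_left h.le]
    · rw [max_eq_right (not_lt.1 h), zero_mul]
  rw [inner_cov hx, integral_congr_ae (ae_of_all _ h2), integral_congr_ae (ae_of_all _ h1),
    integral_add (hi.indicator hpos) (hi.indicator hneg), ← hs]
  ring

omit hx in
lemma UpperHypercontractive.integral_le {α : ℝ} (h : UpperHypercontractive D α) (u w : E) :
    ∫ p, ⟪p.1, w⟫ ^ 2 * ⟪p.1, u⟫ ^ 2 ∂D ≤ α * sqNorm (cov D) w * sqNorm (cov D) u := by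
  have hx := h.memLp
  have h1 := inner_le_of_le (h.le (outer w) (InnerProductSpace.isPositive_rankOne_self w)) u
  have hi : Integrable (fun p : E × ℝ => outer p.1 * outer w * outer p.1) D := by
    refine ((integrable_norm_pow_four hx).mul_const (‖w‖ ^ 2)).mono' ?_ ?_
    · have : Continuous fun x : E => outer x * outer w * outer x :=
        (continuous_outer.mul continuous_const).mul continuous_outer
      exact this.comp_aestronglyMeasurable hx.1
    · refine ae_of_all _ fun p => ?_
      refine (norm_mul_le _ _).trans ?_
      refine (mul_le_mul_of_nonneg_right (norm_mul_le _ _) (norm_nonneg _)).trans (le_of_eq ?_)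
      simp only [norm_outer]
      ring
  rw [ContinuousLinearMap.integral_apply hi, ← integral_inner (hi.apply_continuousLinearMap u),
    trace_mul_outer, smul_apply, inner_smul_right] at h1
  refine le_trans (le_of_eq (integral_congr_ae (ae_of_all _ fun p => ?_))) h1
  simp only [mul_apply_eq_comp, outer_apply, map_smul, inner_smul_right]
  rw [real_inner_comm p.1 u, real_inner_comm w p.1]
  ring

omit hx in
-- Nonnegativity of the variance of (xᵀu)² compares its second moment with its squared mean. This is
-- what turns the trace condition on γ₀ into γ₀λᵢ ≤ 1/8.
lemma UpperHypercontractive.one_le {α : ℝ} (h : UpperHypercontractive D α) {u : E}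
    (hu : 0 < sqNorm (cov D) u) : 1 ≤ α := by
  have hx := h.memLp
  have h1 := h.integral_le u u
  have hi := integrable_inner_sq_mul_inner_sq hx u u
  have hi2 : Integrable (fun p : E × ℝ => ⟪p.1, u⟫ ^ 2) D := by
    simpa only [sq] using integrable_inner_mul_inner hx u u
  set s := sqNorm (cov D) u with hs
  have h2 : 0 ≤ ∫ p, (⟪p.1, u⟫ ^ 2 - s) ^ 2 ∂D := by positivity
  have h3 : ∫ p, (⟪p.1, u⟫ ^ 2 - s) ^ 2 ∂D =
      ∫ p, ⟪p.1, u⟫ ^ 2 * ⟪p.1, u⟫ ^ 2 ∂D - s ^ 2 := by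
    have e : ∀ p : E × ℝ, (⟪p.1, u⟫ ^ 2 - s) ^ 2 =
        ⟪p.1, u⟫ ^ 2 * ⟪p.1, u⟫ ^ 2 - 2 * s * ⟪p.1, u⟫ ^ 2 + s ^ 2 := fun p => by ring
    have hi3 : Integrable (fun p : E × ℝ =>
        ⟪p.1, u⟫ ^ 2 * ⟪p.1, u⟫ ^ 2 - 2 * s * ⟪p.1, u⟫ ^ 2) D := hi.sub (hi2.const_mul _)
    rw [integral_congr_ae (ae_of_all _ e), integral_add hi3 (integrable_const _), integral_sub hi (hi2.const_mul _), integral_const_mul,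
      ← sqNorm_cov hx, ← hs]
    simp
    ring
  have h4 : s * s ≤ α * (s * s) := by nlinarith
  by_contra! hα
  nlinarith [mul_pos hu hu]

end Moments

/-! ### The residual, the bias and one step of the algorithm -/

section Noise

variable {E : Type*} [NormedAddCommGroup E] [InnerProductSpace ℝ E] [CompleteSpace E]
  [SecondCountableTopology E] [MeasurableSpace E] [BorelSpace E]
  {D : Measure (E × ℝ)} [IsProbabilityMeasure D]

/-- The residual `y - ReLU(xᵀ w)`. -/
def residual (w : E) (p : E × ℝ) : ℝ := p.2 - relu ⟪p.1, w⟫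

@[fun_prop]
lemma measurable_residual (w : E) : Measurable (residual w) := by
  unfold residual relu; fun_prop

lemma memLp_inner (hx : MemLp (fun p : E × ℝ => p.1) 4 D) (u : E) :
    MemLp (fun p : E × ℝ => ⟪p.1, u⟫) 2 D := by
  rw [memLp_two_iff_integrable_sq (by fun_prop)]
  simpa only [sq] using integrable_inner_mul_inner hx u u

lemma memLp_relu (hx : MemLp (fun p : E × ℝ => p.1) 4 D) (u : E) :
    MemLp (fun p : E × ℝ => relu ⟪p.1, u⟫) 2 D :=
  (memLp_inner hx u).mono (by unfold relu; fun_prop) (ae_of_all _ fun p => abs_relu_le _)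

lemma memLp_residual (hx : MemLp (fun p : E × ℝ => p.1) 4 D)
    (hy : MemLp (fun p : E × ℝ => p.2) 2 D) (w : E) : MemLp (residual w) 2 D :=
  hy.sub (memLp_relu hx w)

lemma residual_sq_le (w w' : E) (p : E × ℝ) :
    residual w p ^ 2 ≤ 2 * ⟪p.1, w - w'⟫ ^ 2 + 2 * residual w' p ^ 2 := by
  have h := relu_sub_sq_le ⟪p.1, w⟫ ⟪p.1, w'⟫
  rw [inner_sub_right]
  have e : residual w p = residual w' p - (relu ⟪p.1, w⟫ - relu ⟪p.1, w'⟫) := by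
    simp only [residual]; ring
  rw [e]
  nlinarith [sq_nonneg (residual w' p + (relu ⟪p.1, w⟫ - relu ⟪p.1, w'⟫))]

lemma risk_eq (w : E) : risk D w = ∫ p, residual w p ^ 2 ∂D := by
  unfold risk residual
  congr 1 with p
  ring

lemma risk_nonneg (w : E) : 0 ≤ risk D w := integral_nonneg fun _ => sq_nonneg _

lemma risk_le_add (hx : MemLp (fun p : E × ℝ => p.1) 4 D)
    (hy : MemLp (fun p : E × ℝ => p.2) 2 D) (w w' : E) :
    risk D w ≤ 2 * sqNorm (cov D) (w - w') + 2 * risk D w' := by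
  have h1 := (memLp_inner hx (w - w')).integrable_sq
  have h2 := (memLp_residual hx hy w').integrable_sq
  rw [risk_eq, risk_eq, sqNorm_cov hx, ← integral_const_mul, ← integral_const_mul,
    ← integral_add (h1.const_mul 2) (h2.const_mul 2)]
  exact integral_mono (memLp_residual hx hy w).integrable_sq
    ((h1.const_mul 2).add (h2.const_mul 2)) (residual_sq_le w w')

variable {wstar : E} {σ : ℝ}

lemma MisspecifiedNoise.opt_eq (hN : MisspecifiedNoise D wstar σ) : opt D = risk D wstar := by
  refine le_antisymm (ciInf_le ⟨0, ?_⟩ wstar) (le_ciInf hN.isMin)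
  rintro _ ⟨w, rfl⟩
  exact risk_nonneg w

lemma MisspecifiedNoise.opt_nonneg (hN : MisspecifiedNoise D wstar σ) : 0 ≤ opt D := by
  rw [hN.opt_eq]
  exact risk_nonneg wstar

lemma MisspecifiedNoise.integrable_norm (hN : MisspecifiedNoise D wstar σ) :
    Integrable (fun p : E × ℝ => residual wstar p ^ 2 * ‖p.1‖ ^ 2) D := by
  refine hN.integrable.norm.congr (ae_of_all _ fun p => ?_)
  simp [norm_smul, norm_outer, residual]

lemma MisspecifiedNoise.integrable_inner (hN : MisspecifiedNoise D wstar σ) (u : E) :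
    Integrable (fun p : E × ℝ => residual wstar p ^ 2 * ⟪p.1, u⟫ ^ 2) D := by
  refine (hN.integrable_norm.mul_const (‖u‖ ^ 2)).mono' (by fun_prop) (ae_of_all _ fun p => ?_)
  rw [norm_mul, norm_pow, norm_pow, Real.norm_eq_abs, sq_abs]
  have := norm_inner_le_norm (𝕜 := ℝ) p.1 u
  calc _ ≤ residual wstar p ^ 2 * (‖p.1‖ * ‖u‖) ^ 2 := by gcongr
    _ = _ := by ring

lemma MisspecifiedNoise.integral_le (hN : MisspecifiedNoise D wstar σ) (u : E) :
    ∫ p, residual wstar p ^ 2 * ⟪p.1, u⟫ ^ 2 ∂D ≤ σ ^ 2 * sqNorm (cov D) u := by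
  have h1 := inner_le_of_le hN.le u
  rw [ContinuousLinearMap.integral_apply hN.integrable,
    ← integral_inner (hN.integrable.apply_continuousLinearMap u),
    smul_apply, inner_smul_right] at h1
  refine le_trans (le_of_eq (integral_congr_ae (ae_of_all _ fun p => ?_))) h1
  simp only [smul_apply, outer_apply, inner_smul_right, residual]
  rw [real_inner_comm p.1 u]
  ring

lemma integrable_residual_mul_inner (hx : MemLp (fun p : E × ℝ => p.1) 4 D)
    (hy : MemLp (fun p : E × ℝ => p.2) 2 D) (w u : E) :
    Integrable (fun p : E × ℝ => residual w p * ⟪p.1, u⟫) D :=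
  (memLp_residual hx hy w).integrable_mul (memLp_inner hx u)

lemma two_mul_integral_residual_le (hx : MemLp (fun p : E × ℝ => p.1) 4 D)
    (hy : MemLp (fun p : E × ℝ => p.2) 2 D) (w u : E) :
    2 * ∫ p, residual w p * ⟪p.1, u⟫ ∂D ≤ risk D w + sqNorm (cov D) u := by
  have h1 := (memLp_inner hx u).integrable_sq
  have h2 := (memLp_residual hx hy w).integrable_sq
  rw [risk_eq, sqNorm_cov hx, ← integral_const_mul, ← integral_add h2 h1]
  refine integral_mono ((integrable_residual_mul_inner hx hy w u).const_mul 2) (h2.add h1)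
    fun p => ?_
  nlinarith [sq_nonneg (residual w p - ⟪p.1, u⟫)]

/-- Applied to c • u, the quadratic inequality becomes linear in c, and a linear function bounded
above vanishes. Thus the division by λᵢ = 0 in `biasCoord` is harmless. -/
lemma integral_residual_eq_zero (hx : MemLp (fun p : E × ℝ => p.1) 4 D)
    (hy : MemLp (fun p : E × ℝ => p.2) 2 D) (w : E) {u : E} (hu : sqNorm (cov D) u = 0) :
    ∫ p, residual w p * ⟪p.1, u⟫ ∂D = 0 := by
  set q := ∫ p, residual w p * ⟪p.1, u⟫ ∂D with hq
  have key : ∀ c : ℝ, 2 * (c * q) ≤ risk D w := by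
    intro c
    have h := two_mul_integral_residual_le hx hy w (c • u)
    have e : sqNorm (cov D) (c • u) = 0 := by
      have : sqNorm (cov D) (c • u) = c ^ 2 * sqNorm (cov D) u := by
        simp only [sqNorm, map_smul, inner_smul_left, inner_smul_right, RCLike.conj_to_real]; ring
      rw [this, hu, mul_zero]
    simp only [inner_smul_right, e, mul_left_comm _ c, integral_const_mul, ← hq, add_zero] at h
    linarith
  by_contra h0
  have := key ((risk D w + 1) / q)
  rw [div_mul_cancel₀ _ h0] at this
  have hr : 0 ≤ risk D w := risk_nonneg w
  linarith

variable {lam : ℕ → ℝ} {v : ℕ → E}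

/-- The `i`-th coordinate of the solution `b` of `H b = E[(y - ReLU(xᵀ w)) x]`. -/
def biasCoord (D : Measure (E × ℝ)) (w : E) (lam : ℕ → ℝ) (v : ℕ → E) (i : ℕ) : ℝ :=
  (∫ p, residual w p * ⟪p.1, v i⟫ ∂D) / lam i

lemma lam_mul_biasCoord (hx : MemLp (fun p : E × ℝ => p.1) 4 D)
    (hy : MemLp (fun p : E × ℝ => p.2) 2 D) (w : E) (hE : IsEigendecomposition (cov D) lam v)
    (i : ℕ) : lam i * biasCoord D w lam v i = ∫ p, residual w p * ⟪p.1, v i⟫ ∂D := by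
  by_cases h : lam i = 0
  · rw [h, zero_mul, integral_residual_eq_zero hx hy w]
    rw [sqNorm, hE.inner_apply, h, zero_mul]
  · rw [biasCoord, mul_div_cancel₀ _ h]

/-- For u = ∑ bᵢvᵢ, both E[residual · xᵀu] and ‖u‖²_H equal S = ∑ λᵢbᵢ², so the quadratic inequality
reads 2S ≤ risk + S. -/
lemma sum_biasCoord_sq_le (hx : MemLp (fun p : E × ℝ => p.1) 4 D)
    (hy : MemLp (fun p : E × ℝ => p.2) 2 D) (w : E) (hE : IsEigendecomposition (cov D) lam v)
    (s : Finset ℕ) : ∑ i ∈ s, lam i * biasCoord D w lam v i ^ 2 ≤ risk D w := by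
  set b := biasCoord D w lam v with hb
  have h := two_mul_integral_residual_le hx hy w (∑ i ∈ s, b i • v i)
  have e1 : ∫ p, residual w p * ⟪p.1, ∑ i ∈ s, b i • v i⟫ ∂D = ∑ i ∈ s, lam i * b i ^ 2 := by
    simp only [inner_sum, inner_smul_right, Finset.mul_sum, mul_left_comm _ (b _)]
    rw [integral_finsetSum _ fun i _ => (integrable_residual_mul_inner hx hy w (v i)).const_mul _]
    refine Finset.sum_congr rfl fun i _ => ?_
    rw [integral_const_mul, ← lam_mul_biasCoord hx hy w hE]
    ring
  have e2 : sqNorm (cov D) (∑ i ∈ s, b i • v i) = ∑ i ∈ s, lam i * b i ^ 2 := by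
    rw [sqNorm, sum_inner]
    refine Finset.sum_congr rfl fun i hi => ?_
    rw [inner_smul_left, hE.inner_apply, inner_sum, Finset.sum_eq_single i]
    · rw [inner_smul_right, real_inner_self_eq_norm_sq, RCLike.conj_to_real]
      linear_combination b i ^ 2 * hE.lam_mul_norm_sq i
    · intro j _ hj
      rw [inner_smul_right, hE.orthogonal i j hj.symm, mul_zero]
    · exact fun h => absurd hi h
  rw [e1, e2] at h
  linarith

/-- One step of GLM-tron contracts the second moment along an eigendirection, up to noise. -/
lemma integral_step_sq_le {α : ℝ} (hsym : SymmetricFeatures D) (hα : UpperHypercontractive D α)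
    (hN : MisspecifiedNoise D wstar σ) (hE : IsEigendecomposition (cov D) lam v) (γ : ℝ) (i : ℕ)
    (w : E) :
    ∫ p, (⟪v i, w - (γ * (relu ⟪p.1, w⟫ - p.2)) • p.1 - wstar⟫ -
        2 * biasCoord D wstar lam v i) ^ 2 ∂D ≤
      (1 - γ * lam i / 2) ^ 2 * (⟪v i, w - wstar⟫ - 2 * biasCoord D wstar lam v i) ^ 2 +
        γ ^ 2 * lam i * (2 * α * sqNorm (cov D) (w - wstar) + 2 * σ ^ 2) := by
  have hx := hα.memLp
  have hy := hN.memLp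
  set b := biasCoord D wstar lam v i with hb
  set Y := ⟪v i, w - wstar⟫ - 2 * b with hY
  have hlam : sqNorm (cov D) (v i) = lam i := by
    rw [sqNorm, hE.inner_apply, real_inner_self_eq_norm_sq, hE.lam_mul_norm_sq]
  have e : ∀ p : E × ℝ, (⟪v i, w - (γ * (relu ⟪p.1, w⟫ - p.2)) • p.1 - wstar⟫ - 2 * b) ^ 2 =
      Y ^ 2 + 2 * γ * Y * (residual w p * ⟪p.1, v i⟫) +
        γ ^ 2 * (residual w p ^ 2 * ⟪p.1, v i⟫ ^ 2) := by
    intro p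
    simp only [hY, residual, inner_sub_right, inner_smul_right, real_inner_comm (v i) p.1]
    rw [real_inner_comm p.1 (v i)]
    ring
  have hle : ∀ p : E × ℝ, residual w p ^ 2 * ⟪p.1, v i⟫ ^ 2 ≤
      2 * (⟪p.1, w - wstar⟫ ^ 2 * ⟪p.1, v i⟫ ^ 2) +
        2 * (residual wstar p ^ 2 * ⟪p.1, v i⟫ ^ 2) := by
    intro p
    have := mul_le_mul_of_nonneg_right (residual_sq_le w wstar p) (sq_nonneg ⟪p.1, v i⟫)
    linarith
  have hi1 := integrable_residual_mul_inner hx hy w (v i)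
  have hi2 := integrable_inner_sq_mul_inner_sq hx (w - wstar) (v i)
  have hi3 := hN.integrable_inner (v i)
  have hi4 : Integrable (fun p : E × ℝ => residual w p ^ 2 * ⟪p.1, v i⟫ ^ 2) D := by
    refine ((hi2.const_mul 2).add (hi3.const_mul 2)).mono' (by fun_prop) (ae_of_all _ fun p => ?_)
    rw [Real.norm_eq_abs, abs_of_nonneg (by positivity)]
    exact hle p
  have h4 : ∫ p, residual w p ^ 2 * ⟪p.1, v i⟫ ^ 2 ∂D ≤
      lam i * (2 * α * sqNorm (cov D) (w - wstar) + 2 * σ ^ 2) := by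
    refine (integral_mono hi4 ((hi2.const_mul 2).add (hi3.const_mul 2)) hle).trans ?_
    have h := integral_add (hi2.const_mul 2) (hi3.const_mul 2)
    simp only [Pi.add_apply]
    rw [h, integral_const_mul, integral_const_mul]
    have h5 := hα.integral_le (v i) (w - wstar)
    have h6 := hN.integral_le (v i)
    rw [hlam] at h5 h6
    linarith
  -- The recentring by 2b is chosen for this identity: the mean of the step is exactly proportional
  -- to the recentred coordinate.
  have h1 : ∫ p, residual w p * ⟪p.1, v i⟫ ∂D = - (lam i / 2 * Y) := by
    have hr : ∀ u : E, Integrable (fun p : E × ℝ => relu ⟪p.1, u⟫ * ⟪p.1, v i⟫) D := fun u =>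
      (memLp_relu hx u).integrable_mul (memLp_inner hx (v i))
    have e1 : ∀ p : E × ℝ, residual w p * ⟪p.1, v i⟫ = residual wstar p * ⟪p.1, v i⟫ +
        (relu ⟪p.1, wstar⟫ * ⟪p.1, v i⟫ - relu ⟪p.1, w⟫ * ⟪p.1, v i⟫) := fun p => by
      simp only [residual]; ring
    have hrs : Integrable (fun p : E × ℝ =>
        relu ⟪p.1, wstar⟫ * ⟪p.1, v i⟫ - relu ⟪p.1, w⟫ * ⟪p.1, v i⟫) D := (hr wstar).sub (hr w)
    rw [integral_congr_ae (ae_of_all _ e1),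
      integral_add (integrable_residual_mul_inner hx hy wstar (v i)) hrs,
      integral_sub (hr wstar) (hr w), ← lam_mul_biasCoord hx hy wstar hE,
      integral_relu_mul_inner hx hsym, integral_relu_mul_inner hx hsym, hE.inner_apply_comm,
      hE.inner_apply_comm w, hE.inner_apply, hE.inner_apply, hY, inner_sub_right]
    ring
  have hi5 : Integrable (fun p : E × ℝ => Y ^ 2 + 2 * γ * Y * (residual w p * ⟪p.1, v i⟫)) D :=
    (integrable_const _).add (hi1.const_mul _)
  rw [integral_congr_ae (ae_of_all _ e), integral_add hi5 (hi4.const_mul _),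
    integral_add (integrable_const _) (hi1.const_mul _), integral_const_mul, integral_const_mul, h1]
  simp only [integral_const, probReal_univ, one_smul]
  have := mul_le_mul_of_nonneg_left h4 (sq_nonneg γ)
  -- The mean part is (1 - γλᵢ)Y², and 1 - γλᵢ ≤ (1 - γλᵢ/2)².
  nlinarith [sq_nonneg (γ * lam i / 2 * Y)]

end Noise

/-! ### The iterates as a Markov chain -/

section Dynamics

variable {E : Type*} [NormedAddCommGroup E] [InnerProductSpace ℝ E] [CompleteSpace E]
  [SecondCountableTopology E] [MeasurableSpace E] [BorelSpace E]
  {D : Measure (E × ℝ)} [IsProbabilityMeasure D]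

/-- One step of GLM-tron from `w` with data point `p` and stepsize `γ`. -/
def tronStep (γ : ℝ) (w : E) (p : E × ℝ) : E := w - (γ * (relu ⟪p.1, w⟫ - p.2)) • p.1

lemma iterate_succ (γ : ℕ → ℝ) (w₀ : E) (z : ℕ → E × ℝ) (t : ℕ) :
    iterate γ w₀ z (t + 1) = tronStep (γ (t + 1)) (iterate γ w₀ z t) (z (t + 1)) := rfl

lemma measurable_tronStep (γ : ℝ) : Measurable fun q : E × (E × ℝ) => tronStep γ q.1 q.2 := by
  unfold tronStep relu
  fun_prop

lemma iterate_congr {γ : ℕ → ℝ} {w₀ : E} {z z' : ℕ → E × ℝ} {t : ℕ}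
    (h : ∀ n, 1 ≤ n → n ≤ t → z n = z' n) : iterate γ w₀ z t = iterate γ w₀ z' t := by
  induction t with
  | zero => rfl
  | succ t ih =>
    rw [iterate_succ, iterate_succ, ih fun n h1 h2 => h n h1 (by omega), h (t + 1) (by omega) le_rfl]

lemma measurable_iterate {X : Type*} [MeasurableSpace X] (γ : ℕ → ℝ) (w₀ : E)
    {z : ℕ → X → E × ℝ} (hz : ∀ n, Measurable (z n)) (t : ℕ) :
    Measurable fun x => iterate γ w₀ (fun n => z n x) t := by
  induction t with
  | zero => exact measurable_const
  | succ t ih => exact (measurable_tronStep (γ (t + 1))).comp (ih.prodMk (hz (t + 1)))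

section Sample

variable {Ω : Type*} [MeasurableSpace Ω] {P : Measure Ω} [IsProbabilityMeasure P] {N : ℕ}
  {z : ℕ → Ω → E × ℝ} (hz : IsIIDSample P D N z) (γ : ℕ → ℝ) (w₀ : E)
include hz

lemma IsIIDSample.aemeasurable_iterate {t : ℕ} (ht : t ≤ N) :
    AEMeasurable (fun ω => iterate γ w₀ (fun n => z n ω) t) P := by
  induction t with
  | zero => exact aemeasurable_const
  | succ t ih =>
    exact (measurable_tronStep (γ (t + 1))).comp_aemeasurable
      ((ih (by omega)).prodMk (hz.hasLaw (t + 1) (Finset.mem_Icc.2 ⟨by omega, ht⟩)).aemeasurable)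

lemma IsIIDSample.indepFun_iterate {t : ℕ} (ht : t < N) :
    IndepFun (fun ω => iterate γ w₀ (fun n => z n ω) t) (z (t + 1)) P := by
  set S : Finset (Fin N) := Finset.univ.filter fun i => i.1 < t with hS
  set T : Finset (Fin N) := {⟨t, ht⟩} with hT
  have hd : Disjoint S T := by
    rw [hT, Finset.disjoint_singleton_right, hS]
    simp
  have hind := iIndepFun.indepFun_finset₀ S T hd hz.indep fun i =>
    (hz.hasLaw (i + 1) (Finset.mem_Icc.2 ⟨by omega, by omega⟩)).aemeasurable
  have hmem : ∀ n, 1 ≤ n ∧ n ≤ t → n - 1 < N := fun n hn => by omega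
  have hmemS : ∀ n (hn : 1 ≤ n ∧ n ≤ t), (⟨n - 1, hmem n hn⟩ : Fin N) ∈ S := fun n hn => by
    rw [hS, Finset.mem_filter]
    exact ⟨Finset.mem_univ _, by simp only; omega⟩
  -- Rebuilds a data stream from the first t sample points, with 0 elsewhere; the iterate at time t
  -- reads nothing else, so it is a function of those points alone.
  let ζ : ℕ → (S → E × ℝ) → E × ℝ := fun n g =>
    if hn : 1 ≤ n ∧ n ≤ t then g ⟨⟨n - 1, hmem n hn⟩, hmemS n hn⟩ else 0
  have hζ : ∀ n, Measurable (ζ n) := by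
    intro n
    by_cases hn : 1 ≤ n ∧ n ≤ t
    · simp only [ζ, hn, and_self, dif_pos]
      exact measurable_pi_apply _
    · simp only [ζ, hn, dif_neg, not_false_eq_true]
      exact measurable_const
  have h := hind.comp (measurable_iterate γ w₀ hζ t)
    (measurable_pi_apply (⟨⟨t, ht⟩, Finset.mem_singleton_self _⟩ : T))
  have e : (fun ω => iterate γ w₀ (fun n => z n ω) t) =
      fun ω => iterate γ w₀ (fun n => ζ n fun i => z (i.1.1 + 1) ω) t := by
    ext1 ω
    refine iterate_congr fun n h1 h2 => ?_
    simp only [ζ, h1, h2, and_self, dif_pos]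
    rw [Nat.sub_add_cancel h1]
  rw [e]
  exact h

lemma IsIIDSample.map_iterate_succ {t : ℕ} (ht : t < N) :
    P.map (fun ω => iterate γ w₀ (fun n => z n ω) (t + 1)) =
      ((P.map fun ω => iterate γ w₀ (fun n => z n ω) t).prod D).map
        fun q => tronStep (γ (t + 1)) q.1 q.2 := by
  have hlaw := hz.hasLaw (t + 1) (Finset.mem_Icc.2 ⟨by omega, ht⟩)
  have hW := hz.aemeasurable_iterate γ w₀ ht.le
  have h := (indepFun_iff_map_prod_eq_prod_map_map hW hlaw.aemeasurable).1
    (hz.indepFun_iterate γ w₀ ht)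
  rw [hlaw.map_eq] at h
  rw [← h, AEMeasurable.map_map_of_aemeasurable (measurable_tronStep _).aemeasurable
    (hW.prodMk hlaw.aemeasurable)]
  rfl

end Sample

/-! ### Evolution of the law of the iterate -/

section Laws

variable {α σ : ℝ} {wstar : E} {lam : ℕ → ℝ} {v : ℕ → E} {μ : Measure E} [IsProbabilityMeasure μ]

lemma integrable_norm_tronStep_sq (hα : UpperHypercontractive D α)
    (hN : MisspecifiedNoise D wstar σ) (hμ : Integrable (fun w => ‖w - wstar‖ ^ 2) μ) (γ : ℝ) :
    Integrable (fun q : E × (E × ℝ) => ‖tronStep γ q.1 q.2 - wstar‖ ^ 2) (μ.prod D) := by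
  have hm := measurable_tronStep (E := E) γ
  have h1 : Integrable (fun q : E × (E × ℝ) => ‖q.1 - wstar‖ ^ 2) (μ.prod D) := hμ.comp_fst D
  have h2 : Integrable (fun q : E × (E × ℝ) => ‖q.1 - wstar‖ ^ 2 * ‖q.2.1‖ ^ 4) (μ.prod D) :=
    hμ.mul_prod (integrable_norm_pow_four hα.memLp)
  have h3 : Integrable (fun q : E × (E × ℝ) => residual wstar q.2 ^ 2 * ‖q.2.1‖ ^ 2) (μ.prod D) :=
    hN.integrable_norm.comp_snd μ
  refine (((h1.const_mul 2).add (h2.const_mul (4 * γ ^ 2))).add (h3.const_mul (4 * γ ^ 2))).mono'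
    (by fun_prop) (ae_of_all _ ?_)
  rintro ⟨w, p⟩
  simp only [Pi.add_apply]
  rw [Real.norm_eq_abs, abs_of_nonneg (sq_nonneg _)]
  have e : tronStep γ w p - wstar = (w - wstar) + (γ * residual w p) • p.1 := by
    simp only [tronStep, residual]
    rw [← neg_sub (relu _), mul_neg, neg_smul]
    abel
  have e1 : ‖tronStep γ w p - wstar‖ ≤ ‖w - wstar‖ + ‖(γ * residual w p) • p.1‖ := by
    rw [e]; exact norm_add_le _ _
  have e2 : ‖(γ * residual w p) • p.1‖ ^ 2 = γ ^ 2 * (residual w p ^ 2 * ‖p.1‖ ^ 2) := by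
    rw [norm_smul, mul_pow, Real.norm_eq_abs, sq_abs]; ring
  have e3 : ‖tronStep γ w p - wstar‖ ^ 2 ≤
      2 * ‖w - wstar‖ ^ 2 + 2 * ‖(γ * residual w p) • p.1‖ ^ 2 := by
    refine (pow_le_pow_left₀ (norm_nonneg _) e1 2).trans ?_
    nlinarith [sq_nonneg (‖w - wstar‖ - ‖(γ * residual w p) • p.1‖)]
  have e4 : ⟪p.1, w - wstar⟫ ^ 2 ≤ (‖p.1‖ * ‖w - wstar‖) ^ 2 := by
    rw [← sq_abs ⟪p.1, w - wstar⟫]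
    exact pow_le_pow_left₀ (abs_nonneg _) (abs_real_inner_le_norm _ _) 2
  have e5 := residual_sq_le w wstar p
  have e6 : residual w p ^ 2 * ‖p.1‖ ^ 2 ≤
      (2 * (‖p.1‖ * ‖w - wstar‖) ^ 2 + 2 * residual wstar p ^ 2) * ‖p.1‖ ^ 2 :=
    mul_le_mul_of_nonneg_right (by linarith) (sq_nonneg _)
  have e7 := mul_le_mul_of_nonneg_left e6 (sq_nonneg γ)
  rw [e2] at e3
  nlinarith

lemma integrable_inner_sub_sq (hμ : Integrable (fun w => ‖w - wstar‖ ^ 2) μ) (u : E) (c : ℝ) :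
    Integrable (fun w => (⟪u, w - wstar⟫ - c) ^ 2) μ := by
  refine ((hμ.const_mul (2 * ‖u‖ ^ 2)).add (integrable_const (2 * c ^ 2))).mono' (by fun_prop)
    (ae_of_all _ fun w => ?_)
  rw [Real.norm_eq_abs, abs_of_nonneg (sq_nonneg _)]
  have e4 : ⟪u, w - wstar⟫ ^ 2 ≤ (‖u‖ * ‖w - wstar‖) ^ 2 := by
    rw [← sq_abs ⟪u, w - wstar⟫]
    exact pow_le_pow_left₀ (abs_nonneg _) (abs_real_inner_le_norm _ _) 2
  simp only [Pi.add_apply]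
  nlinarith [sq_nonneg (⟪u, w - wstar⟫ + c)]

lemma integrable_sqNorm_sub (A : E →L[ℝ] E) (hμ : Integrable (fun w => ‖w - wstar‖ ^ 2) μ) :
    Integrable (fun w => sqNorm A (w - wstar)) μ := by
  unfold sqNorm
  refine (hμ.const_mul ‖A‖).mono' (by fun_prop) (ae_of_all _ fun w => ?_)
  refine (norm_inner_le_norm _ _).trans ?_
  have := A.le_opNorm (w - wstar)
  nlinarith [norm_nonneg (w - wstar)]

/-- The second moment of `w - w_*`, recentred at the fixed point of the mean dynamics, along the
`i`-th eigendirection. -/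
def coordMoment (D : Measure (E × ℝ)) (wstar : E) (lam : ℕ → ℝ) (v : ℕ → E) (μ : Measure E)
    (i : ℕ) : ℝ :=
  ∫ w, (⟪v i, w - wstar⟫ - 2 * biasCoord D wstar lam v i) ^ 2 ∂μ

omit [IsProbabilityMeasure μ] in
lemma coordMoment_nonneg (i : ℕ) : 0 ≤ coordMoment D wstar lam v μ i :=
  integral_nonneg fun _ => sq_nonneg _

lemma summable_biasCoord (hα : UpperHypercontractive D α) (hN : MisspecifiedNoise D wstar σ)
    (hE : IsEigendecomposition (cov D) lam v) :
    Summable fun i => lam i * biasCoord D wstar lam v i ^ 2 :=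
  summable_of_sum_le (fun i => mul_nonneg (hE.nonneg i) (sq_nonneg _))
    (sum_biasCoord_sq_le hα.memLp hN.memLp wstar hE)

lemma tsum_biasCoord_le (hα : UpperHypercontractive D α) (hN : MisspecifiedNoise D wstar σ)
    (hE : IsEigendecomposition (cov D) lam v) :
    ∑' i, lam i * biasCoord D wstar lam v i ^ 2 ≤ opt D := by
  rw [hN.opt_eq]
  exact (summable_biasCoord hα hN hE).tsum_le_of_sum_le
    (sum_biasCoord_sq_le hα.memLp hN.memLp wstar hE)

lemma hasSum_integral_sqNorm (hα : UpperHypercontractive D α)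
    (hE : IsEigendecomposition (cov D) lam v) (hμ : Integrable (fun w => ‖w - wstar‖ ^ 2) μ) :
    HasSum (fun i => lam i * ∫ w, ⟪v i, w - wstar⟫ ^ 2 ∂μ)
      (∫ w, sqNorm (cov D) (w - wstar) ∂μ) := by
  have hi : ∀ i, Integrable (fun w => ⟪v i, w - wstar⟫ ^ 2) μ := fun i => by
    simpa using integrable_inner_sub_sq hμ (v i) 0
  have hle : ∀ i, ∫ w, ⟪v i, w - wstar⟫ ^ 2 ∂μ ≤ ∫ w, ‖w - wstar‖ ^ 2 ∂μ := by
    intro i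
    refine integral_mono (hi i) hμ fun w => ?_
    simp only
    rw [← sq_abs ⟪v i, w - wstar⟫]
    refine pow_le_pow_left₀ (abs_nonneg _) ((abs_real_inner_le_norm _ _).trans ?_) 2
    exact mul_le_of_le_one_left (norm_nonneg _) (hE.norm_le_one i)
  have h := hasSum_integral_of_summable_integral_norm (μ := μ)
    (F := fun i w => lam i * ⟪v i, w - wstar⟫ ^ 2) (fun i => (hi i).const_mul _) (by
      refine Summable.of_nonneg_of_le (fun i => integral_nonneg fun _ => norm_nonneg _)
        (fun i => ?_) ((summable_lam hα.memLp hE).mul_right (∫ w, ‖w - wstar‖ ^ 2 ∂μ))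
      have e : ∀ w, ‖lam i * ⟪v i, w - wstar⟫ ^ 2‖ = lam i * ⟪v i, w - wstar⟫ ^ 2 := fun w => by
        rw [Real.norm_eq_abs, abs_of_nonneg (mul_nonneg (hE.nonneg i) (sq_nonneg _))]
      simp only [e, integral_const_mul]
      exact mul_le_mul_of_nonneg_left (hle i) (hE.nonneg i))
  simp only [integral_const_mul, fun w => (hE.hasSum_sqNorm (w - wstar)).tsum_eq] at h
  exact h

lemma coordMoment_le (hμ : Integrable (fun w => ‖w - wstar‖ ^ 2) μ) (i : ℕ) :
    coordMoment D wstar lam v μ i ≤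
      2 * ∫ w, ⟪v i, w - wstar⟫ ^ 2 ∂μ + 8 * biasCoord D wstar lam v i ^ 2 := by
  have hi : Integrable (fun w => ⟪v i, w - wstar⟫ ^ 2) μ := by
    simpa using integrable_inner_sub_sq hμ (v i) 0
  have e : 2 * ∫ w, ⟪v i, w - wstar⟫ ^ 2 ∂μ + 8 * biasCoord D wstar lam v i ^ 2 =
      ∫ w, 2 * ⟪v i, w - wstar⟫ ^ 2 + 8 * biasCoord D wstar lam v i ^ 2 ∂μ := by
    rw [integral_add (hi.const_mul 2) (integrable_const _), integral_const_mul]; simp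
  rw [e]
  refine integral_mono (integrable_inner_sub_sq hμ _ _)
    ((hi.const_mul 2).add (integrable_const _)) fun w => ?_
  simp only
  nlinarith [sq_nonneg (⟪v i, w - wstar⟫ + 2 * biasCoord D wstar lam v i)]

lemma summable_coordMoment (hα : UpperHypercontractive D α) (hN : MisspecifiedNoise D wstar σ)
    (hE : IsEigendecomposition (cov D) lam v) (hμ : Integrable (fun w => ‖w - wstar‖ ^ 2) μ) :
    Summable fun i => lam i * coordMoment D wstar lam v μ i := by
  refine Summable.of_nonneg_of_le (fun i => mul_nonneg (hE.nonneg i) (coordMoment_nonneg i))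
    (fun i => mul_le_mul_of_nonneg_left (coordMoment_le hμ i) (hE.nonneg i)) ?_
  have h := ((hasSum_integral_sqNorm hα hE hμ).summable.mul_left 2).add
    ((summable_biasCoord hα hN hE).mul_left 8)
  refine h.congr fun i => ?_
  ring

/-- Undoes the recentring: a² ≤ 2(a - 2b)² + 8b², and the b-part sums to at most OPT. -/
lemma integral_sqNorm_le (hα : UpperHypercontractive D α) (hN : MisspecifiedNoise D wstar σ)
    (hE : IsEigendecomposition (cov D) lam v) (hμ : Integrable (fun w => ‖w - wstar‖ ^ 2) μ) :
    ∫ w, sqNorm (cov D) (w - wstar) ∂μ ≤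
      2 * (∑' i, lam i * coordMoment D wstar lam v μ i) + 8 * opt D := by
  have hs := hasSum_integral_sqNorm hα hE hμ
  have h1 := summable_coordMoment hα hN hE hμ
  have h2 := summable_biasCoord hα hN hE
  have hle : ∀ i, lam i * ∫ w, ⟪v i, w - wstar⟫ ^ 2 ∂μ ≤
      2 * (lam i * coordMoment D wstar lam v μ i) + 8 * (lam i * biasCoord D wstar lam v i ^ 2) := by
    intro i
    have hi : Integrable (fun w => ⟪v i, w - wstar⟫ ^ 2) μ := by
      simpa using integrable_inner_sub_sq hμ (v i) 0
    have hj := integrable_inner_sub_sq hμ (v i) (2 * biasCoord D wstar lam v i)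
    have : ∫ w, ⟪v i, w - wstar⟫ ^ 2 ∂μ ≤
        ∫ w, 2 * (⟪v i, w - wstar⟫ - 2 * biasCoord D wstar lam v i) ^ 2 +
          8 * biasCoord D wstar lam v i ^ 2 ∂μ := by
      refine integral_mono hi ((hj.const_mul 2).add (integrable_const _)) fun w => ?_
      simp only
      nlinarith [sq_nonneg (⟪v i, w - wstar⟫ - 4 * biasCoord D wstar lam v i)]
    rw [integral_add (hj.const_mul 2) (integrable_const _), integral_const_mul] at this
    have h3 := mul_le_mul_of_nonneg_left this (hE.nonneg i)
    simp only [integral_const, probReal_univ, one_smul] at h3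
    unfold coordMoment
    linarith
  have h3 := hasSum_le hle hs ((h1.hasSum.mul_left 2).add (h2.hasSum.mul_left 8))
  have h4 := tsum_biasCoord_le hα hN hE
  linarith

/-- `integral_step_sq_le` averaged over w by Fubini. The gain 2α‖w - w_*‖²_H + 2σ² is rewritten
through `integral_sqNorm_le`, which produces 4α and the term 16α OPT. -/
lemma coordMoment_map_le (hsym : SymmetricFeatures D) (hα : UpperHypercontractive D α)
    (hN : MisspecifiedNoise D wstar σ) (hE : IsEigendecomposition (cov D) lam v)
    (hμ : Integrable (fun w => ‖w - wstar‖ ^ 2) μ) (γ : ℝ) (i : ℕ) :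
    coordMoment D wstar lam v ((μ.prod D).map fun q => tronStep γ q.1 q.2) i ≤
      (1 - γ * lam i / 2) ^ 2 * coordMoment D wstar lam v μ i +
        γ ^ 2 * lam i * (4 * α * (∑' j, lam j * coordMoment D wstar lam v μ j) +
          (16 * α * opt D + 2 * σ ^ 2)) := by
  have hm := measurable_tronStep (E := E) γ
  have hint := integrable_norm_tronStep_sq hα hN hμ γ
  set b := biasCoord D wstar lam v i with hb
  have : IsProbabilityMeasure ((μ.prod D).map fun q => tronStep γ q.1 q.2) :=
    Measure.isProbabilityMeasure_map hm.aemeasurable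
  have hint' : Integrable (fun w => ‖w - wstar‖ ^ 2)
      ((μ.prod D).map fun q => tronStep γ q.1 q.2) :=
    (integrable_map_measure (by fun_prop) hm.aemeasurable).2 hint
  have hint2 : Integrable (fun q : E × (E × ℝ) =>
      (⟪v i, tronStep γ q.1 q.2 - wstar⟫ - 2 * b) ^ 2) (μ.prod D) :=
    (integrable_map_measure (by fun_prop) hm.aemeasurable).1
      (integrable_inner_sub_sq hint' (v i) (2 * b))
  have e1 : coordMoment D wstar lam v ((μ.prod D).map fun q => tronStep γ q.1 q.2) i =
      ∫ w, ∫ p, (⟪v i, tronStep γ w p - wstar⟫ - 2 * b) ^ 2 ∂D ∂μ := by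
    rw [coordMoment, integral_map hm.aemeasurable (by fun_prop), integral_prod _ hint2]
  have hj := integrable_inner_sub_sq hμ (v i) (2 * b)
  have hk := integrable_sqNorm_sub (cov D) hμ
  have hl : Integrable (fun w => γ ^ 2 * lam i *
      (2 * α * sqNorm (cov D) (w - wstar) + 2 * σ ^ 2)) μ :=
    ((hk.const_mul (2 * α)).add (integrable_const (2 * σ ^ 2))).const_mul (γ ^ 2 * lam i)
  have h1 := integral_mono hint2.integral_prod_left
    ((hj.const_mul ((1 - γ * lam i / 2) ^ 2)).add hl)
    (fun w => integral_step_sq_le hsym hα hN hE γ i w)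
  simp only [Pi.add_apply] at h1
  rw [integral_add (hj.const_mul _) hl,
    integral_const_mul, integral_const_mul,
    integral_add (hk.const_mul (2 * α)) (integrable_const (2 * σ ^ 2)), integral_const_mul] at h1
  simp only [integral_const, probReal_univ, one_smul] at h1
  rw [e1]
  refine h1.trans (add_le_add_right (mul_le_mul_of_nonneg_left ?_
    (mul_nonneg (sq_nonneg _) (hE.nonneg i))) _)
  have h2 := mul_le_mul_of_nonneg_left (integral_sqNorm_le hα hN hE hμ)
    (show 0 ≤ 2 * α by linarith [hα.pos])
  linarith

end Laws
end Dynamics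

/-! ### Numerical facts on the epoch length -/

section Numerics

lemma logb_two_le_sqrt {N : ℕ} (hN : 100 < N) : Real.logb 2 N ≤ √N := by
  have hN' : (100:ℝ) ≤ N := by exact_mod_cast hN.le
  have hl2 : 0 < Real.log 2 := Real.log_pos (by norm_num)
  have he : Real.exp 2 ≤ 100 := by
    have h1 : Real.exp 2 = Real.exp 1 * Real.exp 1 := by rw [← Real.exp_add]; norm_num
    have h2 := Real.exp_one_lt_d9
    have h3 := Real.exp_pos 1
    rw [h1]; nlinarith
  -- log x / √x decreases from e² on, so it suffices to look at 100, where 100 ≤ 2^10 decides.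
  have h1 := Real.log_div_sqrt_antitoneOn (Set.mem_Ici.2 he) (Set.mem_Ici.2 (he.trans hN')) hN'
  have hs : √(100:ℝ) = 10 := by
    rw [show (100:ℝ) = 10 ^ 2 by norm_num]; exact Real.sqrt_sq (by norm_num)
  have h2 : Real.log 100 ≤ 10 * Real.log 2 := by
    have h := Real.log_le_log (by norm_num) (show (100:ℝ) ≤ 2 ^ 10 by norm_num)
    rw [Real.log_pow] at h
    exact_mod_cast h
  simp only [hs] at h1
  have h3 : Real.log N / √N ≤ Real.log 2 := h1.trans (by rw [div_le_iff₀ (by norm_num)]; linarith)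
  rw [div_le_iff₀ (Real.sqrt_pos.2 (by linarith))] at h3
  rw [Real.logb, div_le_iff₀ hl2]
  linarith

lemma epoch_length_bounds {N K : ℕ} (hN : 100 < N) {Neff : ℝ} (hNeff : Neff = N / Real.logb 2 N)
    (hK : |(K : ℝ) - Neff| < 1) :
    10 ≤ Neff ∧ 2 ≤ K ∧ 2 * K ≤ N ∧ (K : ℝ) ≤ 8 * 2 ^ (N / K) := by
  have hN' : (100:ℝ) < N := by exact_mod_cast hN
  have hN0 : (0:ℝ) < N := by linarith
  set L := Real.logb 2 N with hL
  have hLs : L ≤ √N := logb_two_le_sqrt hN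
  have hss : √(N:ℝ) * √N = N := Real.mul_self_sqrt hN0.le
  have hs10 : 10 ≤ √(N:ℝ) := Real.le_sqrt_of_sq_le (by linarith)
  have hL6 : 6 ≤ L := by
    rw [hL, Real.le_logb_iff_rpow_le (by norm_num) hN0]
    norm_num
    linarith
  have hNL : Neff * L = N := by rw [hNeff]; field_simp
  have hNs : √(N:ℝ) ≤ Neff := by
    rw [hNeff, le_div_iff₀ (by linarith)]
    nlinarith
  obtain ⟨h1, h2⟩ := abs_lt.1 hK
  have hK9 : (9:ℝ) < K := by linarith
  have hK2 : 9 < K := by exact_mod_cast hK9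
  have hN6 : 6 * Neff ≤ N := by nlinarith
  refine ⟨by linarith, by omega, ?_, ?_⟩
  · have : (2 * K : ℝ) ≤ N := by linarith
    exact_mod_cast this
  · set m := N / K with hm
    have h3 : N < K * (m + 1) := Nat.lt_mul_div_succ N (by omega)
    have h4 : (N:ℝ) < K * (m + 1) := by exact_mod_cast h3
    have h5 : (N:ℝ) < (m + 1) * (Neff + 1) := by nlinarith
    -- Otherwise N < (L - 1)(Neff + 1) = N + L - Neff - 1, against L ≤ √N ≤ Neff.
    have h6 : L - 1 ≤ m + 1 := by
      by_contra! h
      nlinarith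
    have h7 : (N:ℝ) / 2 ≤ 2 ^ (m + 1) := by
      have e1 : (2:ℝ) ^ (L - 1) = N / 2 := by
        rw [Real.rpow_sub_one (by norm_num), hL, Real.rpow_logb (by norm_num) (by norm_num) hN0]
      rw [← e1, ← Real.rpow_natCast]
      exact Real.rpow_le_rpow_of_exponent_le (by norm_num) (by push_cast; exact h6)
    rw [pow_succ] at h7
    linarith

end Numerics

lemma tsum_le_of_nonneg_of_le_of_hasSum {f g : ℕ → ℝ} {a : ℝ} (hf : ∀ i, 0 ≤ f i) (hfg : ∀ i, f i ≤ g i)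
    (hg : HasSum g a) : ∑' i, f i ≤ a :=
  hasSum_le hfg (Summable.of_nonneg_of_le hf hfg hg.summable).hasSum hg

/-! ### Translation to SNR and effective dimension -/

section Main

variable {E : Type*} [NormedAddCommGroup E] [InnerProductSpace ℝ E] [CompleteSpace E]
  [SecondCountableTopology E] [MeasurableSpace E] [BorelSpace E]
  {D : Measure (E × ℝ)} [IsProbabilityMeasure D]
  {α σ : ℝ} {wstar w₀ : E} {lam : ℕ → ℝ} {v : ℕ → E}

lemma measurable_risk : Measurable (risk D) := by
  have h : StronglyMeasurable fun q : E × (E × ℝ) => (relu ⟪q.2.1, q.1⟫ - q.2.2) ^ 2 := by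
    unfold relu
    exact Measurable.stronglyMeasurable (by fun_prop)
  exact h.integral_prod_right.measurable

lemma sqNorm_mixed (hx : MemLp (fun p : E × ℝ => p.1) 4 D)
    (hE : IsEigendecomposition (cov D) lam v) (c : ℝ) (k : ℕ) (w : E) :
    sqNorm (c • headProj v k + tailOp lam v k) w =
      c * ∑ i ∈ Finset.range k, ⟪v i, w⟫ ^ 2 + ∑' i, lam (i + k) * ⟪v (i + k), w⟫ ^ 2 := by
  rw [sqNorm_smul_add, sqNorm_headProj, hE.sqNorm_tailOp (summable_lam hx hE)]
  simp only [add_comm k]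

lemma sqNorm_mixed_le (hx : MemLp (fun p : E × ℝ => p.1) 4 D)
    (hE : IsEigendecomposition (cov D) lam v) {c : ℝ} {k : ℕ} (hc : ∀ i < k, c ≤ lam i) (w : E) :
    sqNorm (c • headProj v k + tailOp lam v k) w ≤ sqNorm (cov D) w := by
  have hs := hE.hasSum_sqNorm w
  rw [sqNorm_mixed hx hE, ← hs.tsum_eq, ← hs.summable.sum_add_tsum_nat_add k, Finset.mul_sum]
  refine add_le_add_left (Finset.sum_le_sum fun i hi => ?_) _
  exact mul_le_mul_of_nonneg_right (hc i (Finset.mem_range.1 hi)) (sq_nonneg _)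

/-- The minimum is bounded by c on the first k indices and by λᵢ on the rest, which is why every k
is allowed. -/
lemma tsum_min_mul_le (hx : MemLp (fun p : E × ℝ => p.1) 4 D)
    (hE : IsEigendecomposition (cov D) lam v) {c : ℝ} (hc : 0 ≤ c) (k : ℕ) (w : E) :
    (Summable fun i => min (lam i) c * ⟪v i, w⟫ ^ 2) ∧
    ∑' i, min (lam i) c * ⟪v i, w⟫ ^ 2 ≤ sqNorm (c • headProj v k + tailOp lam v k) w := by
  have hs := (hE.hasSum_sqNorm w).summable
  have h1 : Summable fun i => min (lam i) c * ⟪v i, w⟫ ^ 2 :=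
    Summable.of_nonneg_of_le
      (fun i => mul_nonneg (le_min (hE.nonneg i) hc) (sq_nonneg _))
      (fun i => mul_le_mul_of_nonneg_right (min_le_left _ _) (sq_nonneg _)) hs
  refine ⟨h1, ?_⟩
  rw [sqNorm_mixed hx hE, ← h1.sum_add_tsum_nat_add k, Finset.mul_sum]
  refine add_le_add (Finset.sum_le_sum fun i _ =>
    mul_le_mul_of_nonneg_right (min_le_right _ _) (sq_nonneg _)) ?_
  exact ((summable_nat_add_iff k).2 h1).tsum_le_tsum
    (fun i => mul_le_mul_of_nonneg_right (min_le_left _ _) (sq_nonneg _))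
    ((summable_nat_add_iff k).2 hs)

/-- The same splitting: 1/K² on the first k indices, γ₀²λᵢ² on the rest, with K and Neff comparable
up to a factor 2. -/
lemma mul_tsum_min_le_effDim (hl : ∀ i, 0 ≤ lam i) (hs : Summable lam) {γ₀ Neff : ℝ} {K : ℕ}
    (hNeff : 0 < Neff) (h1 : Neff ≤ 2 * K) (h2 : K ≤ 2 * Neff) (k : ℕ) :
    K * ∑' i, min (γ₀ ^ 2 * lam i ^ 2) (1 / (K:ℝ) ^ 2) ≤
      2 * (effDim lam Neff γ₀ k / Neff) := by
  have hK : (0:ℝ) < K := by linarith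
  have hsq : Summable fun i => γ₀ ^ 2 * lam i ^ 2 := by
    refine Summable.mul_left _ ?_
    refine Summable.of_nonneg_of_le (fun i => sq_nonneg _) (fun i => ?_)
      (hs.mul_left (∑' i, lam i))
    rw [sq]
    exact mul_le_mul_of_nonneg_right (hs.le_tsum i fun j _ => hl j) (hl i)
  have hm : Summable fun i => min (γ₀ ^ 2 * lam i ^ 2) (1 / (K:ℝ) ^ 2) :=
    Summable.of_nonneg_of_le (fun i => le_min (by positivity) (by positivity))
      (fun i => min_le_left _ _) hsq
  have h3 : ∑ i ∈ Finset.range k, min (γ₀ ^ 2 * lam i ^ 2) (1 / (K:ℝ) ^ 2) ≤ k * (1 / (K:ℝ) ^ 2) := by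
    refine (Finset.sum_le_sum fun i _ => min_le_right _ _).trans (le_of_eq ?_)
    rw [Finset.sum_const, Finset.card_range, nsmul_eq_mul]
  have h4 : ∑' i, min (γ₀ ^ 2 * lam (i + k) ^ 2) (1 / (K:ℝ) ^ 2) ≤
      γ₀ ^ 2 * ∑' i, lam (k + i) ^ 2 := by
    rw [← tsum_mul_left]
    simp only [add_comm k]
    exact ((summable_nat_add_iff k).2 hm).tsum_le_tsum (fun i => min_le_left _ _)
      ((summable_nat_add_iff k).2 hsq)
  have hT : 0 ≤ γ₀ ^ 2 * ∑' i, lam (k + i) ^ 2 :=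
    mul_nonneg (sq_nonneg _) (tsum_nonneg fun i => sq_nonneg _)
  have h5 : effDim lam Neff γ₀ k / Neff = k / Neff + Neff * (γ₀ ^ 2 * ∑' i, lam (k + i) ^ 2) := by
    unfold effDim; field_simp
  rw [h5, ← hm.sum_add_tsum_nat_add k]
  have h6 := mul_le_mul_of_nonneg_left (add_le_add h3 h4) hK.le
  have h7 : (K:ℝ) * (k * (1 / (K:ℝ) ^ 2)) = k / K := by field_simp
  have h8 : (k:ℝ) / K ≤ 2 * (k / Neff) := by
    rw [← mul_div_assoc, div_le_div_iff₀ hK hNeff]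
    nlinarith [(Nat.cast_nonneg k : (0:ℝ) ≤ k)]
  have h9 := mul_le_mul_of_nonneg_right h2 hT
  refine h6.trans ?_
  rw [mul_add, h7]
  linarith

section Sample

variable {Ω : Type*} [MeasurableSpace Ω] {P : Measure Ω} [IsProbabilityMeasure P] {N : ℕ}
  {z : ℕ → Ω → E × ℝ}

lemma IsIIDSample.integrable_norm_sq (hz : IsIIDSample P D N z) (hα : UpperHypercontractive D α)
    (hN : MisspecifiedNoise D wstar σ) (γ : ℕ → ℝ) (w₀ : E) {t : ℕ} (ht : t ≤ N) :
    Integrable (fun w => ‖w - wstar‖ ^ 2) (P.map fun ω => iterate γ w₀ (fun n => z n ω) t) := by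
  induction t with
  | zero =>
    refine (integrable_map_measure (by fun_prop) (hz.aemeasurable_iterate γ w₀ ht)).2 ?_
    exact integrable_const (‖w₀ - wstar‖ ^ 2)
  | succ t ih =>
    have : IsProbabilityMeasure (P.map fun ω => iterate γ w₀ (fun n => z n ω) t) :=
      Measure.isProbabilityMeasure_map (hz.aemeasurable_iterate γ w₀ (by omega))
    rw [hz.map_iterate_succ γ w₀ ht]
    exact (integrable_map_measure (by fun_prop) (measurable_tronStep _).aemeasurable).2
      (integrable_norm_tronStep_sq hα hN (ih (by omega)) _)

lemma IsIIDSample.momentSystem (hz : IsIIDSample P D N z) (hsym : SymmetricFeatures D)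
    (hα : UpperHypercontractive D α) (hN : MisspecifiedNoise D wstar σ)
    (hE : IsEigendecomposition (cov D) lam v) {K : ℕ} {γ₀ : ℝ} (hK : 2 ≤ K) (hKN : 2 * K ≤ N)
    (hpow : (K : ℝ) ≤ 8 * 2 ^ (N / K)) (hγ : 0 < γ₀) (htr : 8 * α * trace (cov D) * γ₀ < 1)
    (w₀ : E) :
    MomentSystem K N γ₀ α (16 * α * opt D + 2 * σ ^ 2) lam fun t i =>
      coordMoment D wstar lam v
        (P.map fun ω => iterate (stepSize K γ₀) w₀ (fun n => z n ω) t) i := by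
  have hx := hα.memLp
  have hα0 := hα.pos
  have hT := tsum_lam_le_trace hx hE
  have hs := summable_lam hx hE
  have htr' : 8 * α * (∑' i, lam i) * γ₀ ≤ 1 := by
    have : α * (∑' i, lam i) * γ₀ ≤ α * trace (cov D) * γ₀ := by gcongr
    linarith
  have hprob : ∀ t ≤ N, IsProbabilityMeasure
      (P.map fun ω => iterate (stepSize K γ₀) w₀ (fun n => z n ω) t) := fun t ht =>
    Measure.isProbabilityMeasure_map (hz.aemeasurable_iterate _ w₀ ht)
  refine ⟨hK, hKN, hpow, hγ, hα0, ?_, hE.nonneg, hs, ?_, htr', fun t i => coordMoment_nonneg i,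
    ?_, ?_⟩
  · have := hN.opt_nonneg
    positivity
  · intro i
    rcases (hE.nonneg i).eq_or_lt with h | h
    · rw [← h]; norm_num
    · have h1 : 1 ≤ α := hα.one_le (u := v i) (by
        rwa [sqNorm, hE.inner_apply, real_inner_self_eq_norm_sq, hE.lam_mul_norm_sq])
      have h2 : lam i ≤ ∑' i, lam i := hs.le_tsum i fun j _ => hE.nonneg j
      have h3 : 1 * lam i * γ₀ ≤ α * (∑' i, lam i) * γ₀ := by gcongr
      linarith
  · have := hprob 0 (Nat.zero_le N)
    exact summable_coordMoment hα hN hE (hz.integrable_norm_sq hα hN _ w₀ (Nat.zero_le N))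
  · intro t ht i
    have := hprob t ht.le
    rw [hz.map_iterate_succ _ w₀ ht]
    exact coordMoment_map_le hsym hα hN hE (hz.integrable_norm_sq hα hN _ w₀ ht.le) _ i

lemma tsum_contraction_le (hα : UpperHypercontractive D α) (hN : MisspecifiedNoise D wstar σ)
    (hE : IsEigendecomposition (cov D) lam v) {K : ℕ} {γ₀ : ℝ} (N : ℕ)
    (hfac : ∀ i, ∏ t ∈ Finset.range N, (1 - stepSize K γ₀ (t + 1) * lam i / 2) ^ 2 ≤ 1) (w : E) :
    ∑' i, lam i * ((∏ t ∈ Finset.range N, (1 - stepSize K γ₀ (t + 1) * lam i / 2) ^ 2) *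
        (⟪v i, w⟫ - 2 * biasCoord D wstar lam v i) ^ 2) ≤
      2 * sqNorm (cov D) (contraction (stepSize K γ₀) (cov D) N w) + 8 * opt D := by
  have h1 := (hE.hasSum_sqNorm (contraction (stepSize K γ₀) (cov D) N w)).mul_left 2
  have h2 := (summable_biasCoord hα hN hE).hasSum.mul_left 8
  have h3 := tsum_biasCoord_le hα hN hE
  refine le_trans ?_ (add_le_add_right (mul_le_mul_of_nonneg_left h3 (by norm_num : (0:ℝ) ≤ 8)) _)
  have hfac0 : ∀ i, 0 ≤ ∏ t ∈ Finset.range N, (1 - stepSize K γ₀ (t + 1) * lam i / 2) ^ 2 :=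
    fun i => Finset.prod_nonneg fun t _ => sq_nonneg _
  refine tsum_le_of_nonneg_of_le_of_hasSum (fun i => mul_nonneg (hE.nonneg i)
    (mul_nonneg (hfac0 i) (sq_nonneg _))) (fun i => ?_) (h1.add h2)
  rw [hE.inner_contraction, mul_pow, ← Finset.prod_pow]
  have h4 : (⟪v i, w⟫ - 2 * biasCoord D wstar lam v i) ^ 2 ≤
      2 * ⟪v i, w⟫ ^ 2 + 8 * biasCoord D wstar lam v i ^ 2 := by
    nlinarith [sq_nonneg (⟪v i, w⟫ + 2 * biasCoord D wstar lam v i)]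
  have h5 := mul_le_mul_of_nonneg_left (mul_le_mul_of_nonneg_left h4 (hfac0 i)) (hE.nonneg i)
  have h6 := mul_le_mul_of_nonneg_left (mul_le_mul_of_nonneg_right (hfac i)
    (sq_nonneg (biasCoord D wstar lam v i))) (hE.nonneg i)
  linarith

lemma tsum_min_coord_le (hα : UpperHypercontractive D α) (hN : MisspecifiedNoise D wstar σ)
    (hE : IsEigendecomposition (cov D) lam v) {c : ℝ} (hc : 0 ≤ c) (k : ℕ) (w : E) :
    ∑' i, min (lam i) c * (⟪v i, w⟫ - 2 * biasCoord D wstar lam v i) ^ 2 ≤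
      2 * sqNorm (c • headProj v k + tailOp lam v k) w + 8 * opt D := by
  obtain ⟨hs, hle⟩ := tsum_min_mul_le hα.memLp hE hc k w
  have h2 := (summable_biasCoord hα hN hE).hasSum.mul_left 8
  have h3 := tsum_biasCoord_le hα hN hE
  refine le_trans ?_ (add_le_add (mul_le_mul_of_nonneg_left hle (by norm_num : (0:ℝ) ≤ 2))
    (mul_le_mul_of_nonneg_left h3 (by norm_num : (0:ℝ) ≤ 8)))
  have hm0 : ∀ i, 0 ≤ min (lam i) c := fun i => le_min (hE.nonneg i) hc
  refine tsum_le_of_nonneg_of_le_of_hasSum (fun i => mul_nonneg (hm0 i) (sq_nonneg _)) (fun i => ?_)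
    ((hs.hasSum.mul_left 2).add h2)
  have h4 : (⟪v i, w⟫ - 2 * biasCoord D wstar lam v i) ^ 2 ≤
      2 * ⟪v i, w⟫ ^ 2 + 8 * biasCoord D wstar lam v i ^ 2 := by
    nlinarith [sq_nonneg (⟪v i, w⟫ + 2 * biasCoord D wstar lam v i)]
  have h5 := mul_le_mul_of_nonneg_left h4 (hm0 i)
  have h6 := mul_le_mul_of_nonneg_right (min_le_left (lam i) c)
    (sq_nonneg (biasCoord D wstar lam v i))
  linarith

end Sample
end Main

end GLMTron

end

/-- Here `Neff = N / log₂ N`, and the stepsizes are halved every `K` steps, where `K` is `Neff`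
rounded (down or up) to an integer. The constant `C` is absolute. -/
theorem mainTheorem2 :
    ∃ C : ℝ, 0 < C ∧
      ∀ (E : Type u) [NormedAddCommGroup E] [InnerProductSpace ℝ E] [CompleteSpace E]
        [SecondCountableTopology E] [MeasurableSpace E] [BorelSpace E]
        (D : Measure (E × ℝ)) [IsProbabilityMeasure D]
        (α σ : ℝ) (wstar w₀ : E)
        (_ : SymmetricFeatures D) (_ : UpperHypercontractive D α)
        (_ : MisspecifiedNoise D wstar σ)
        (lam : ℕ → ℝ) (ev : ℕ → E) (_ : IsEigendecomposition (cov D) lam ev)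
        (Ω : Type v) [MeasurableSpace Ω] (P : Measure Ω) [IsProbabilityMeasure P]
        (N : ℕ) (_ : 100 < N) (z : ℕ → Ω → E × ℝ) (_ : IsIIDSample P D N z)
        (Neff : ℝ) (_ : Neff = N / Real.logb 2 N)
        (K : ℕ) (_ : |(K : ℝ) - Neff| < 1)
        (γ₀ : ℝ) (_ : 0 < γ₀) (_ : 8 * α * trace (cov D) * γ₀ < 1)
        (k : ℕ),
        (Integrable
            (fun ω => risk D (iterate (stepSize K γ₀) w₀ (fun t => z t ω) N)) P ∧
          ∫ ω, risk D (iterate (stepSize K γ₀) w₀ (fun t => z t ω) N) ∂P ≤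
            C * (opt D +
              sqNorm (cov D) (contraction (stepSize K γ₀) (cov D) N (w₀ - wstar)) +
              (1 + snr D α σ w₀ wstar lam ev Neff γ₀ k) * σ ^ 2 *
                (effDim lam Neff γ₀ k / Neff))) ∧
        ((∀ i < k, 1 / (Neff * γ₀) ≤ lam i) →
          snr D α σ w₀ wstar lam ev Neff γ₀ k ≤
            α * (opt D + sqNorm (cov D) wstar + sqNorm (cov D) (w₀ - wstar)) / σ ^ 2) := by
  -- 134400 = 4 · 700 · 24 · 2: passing from recentred moments to the risk, the bound `risk_le`, the
  -- comparison with (1 + SNR)σ², and the comparison with D_eff/N_eff. The OPT and bias terms need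
  -- far less.
  refine ⟨134400, by norm_num, ?_⟩
  intro E _ _ _ _ _ _ D _ α σ wstar w₀ hsym hα hnoise lam ev hE Ω _ P _ N hN z hz Neff hNeff K hK
    γ₀ hγ htr k
  obtain ⟨hNeff10, hK2, hKN, hpow⟩ := epoch_length_bounds hN hNeff hK
  have hx := hα.memLp
  have hα0 := hα.pos
  have hσ := hnoise.pos
  have hNeff0 : 0 < Neff := by linarith
  refine ⟨?_, fun hk => ?_⟩
  · obtain ⟨hK1, hK1'⟩ := abs_lt.1 hK
    have S := hz.momentSystem hsym hα hnoise hE hK2 hKN hpow hγ htr w₀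
    have hW := hz.aemeasurable_iterate (stepSize K γ₀) w₀ le_rfl
    have hμ := hz.integrable_norm_sq hα hnoise (stepSize K γ₀) w₀ le_rfl
    have hrisk := S.risk_le
    have hy0 : ∀ i, coordMoment D wstar lam ev
        (P.map fun ω => iterate (stepSize K γ₀) w₀ (fun n => z n ω) 0) i =
        (⟪ev i, w₀ - wstar⟫ - 2 * biasCoord D wstar lam ev i) ^ 2 := by
      intro i
      simp [coordMoment, iterate]
    simp only [hy0] at hrisk
    set μ := P.map fun ω => iterate (stepSize K γ₀) w₀ (fun n => z n ω) N with hμdef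
    have : IsProbabilityMeasure μ := Measure.isProbabilityMeasure_map hW
    have hopt := hnoise.opt_nonneg
    have hle : ∀ w, risk D w ≤ 2 * sqNorm (cov D) (w - wstar) + 2 * opt D := fun w => by
      rw [hnoise.opt_eq]; exact risk_le_add hx hnoise.memLp w wstar
    have hsq := integrable_sqNorm_sub (cov D) hμ
    have hint : Integrable (risk D) μ := by
      refine ((hsq.const_mul 2).add (integrable_const (2 * opt D))).mono'
        measurable_risk.aestronglyMeasurable (ae_of_all _ fun w => ?_)
      rw [Real.norm_eq_abs, abs_of_nonneg (risk_nonneg w)]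
      exact hle w
    refine ⟨(integrable_map_measure measurable_risk.aestronglyMeasurable hW).1 hint, ?_⟩
    rw [← integral_map hW measurable_risk.aestronglyMeasurable, ← hμdef]
    have h1 : ∫ w, risk D w ∂μ ≤ 2 * (∫ w, sqNorm (cov D) (w - wstar) ∂μ) + 2 * opt D := by
      have h := integral_mono hint ((hsq.const_mul 2).add (integrable_const (2 * opt D))) hle
      simp only [Pi.add_apply] at h
      rw [integral_add (hsq.const_mul 2) (integrable_const _), integral_const_mul] at h
      simpa using h
    have h2 := integral_sqNorm_le hα hnoise hE hμ
    have h3 := tsum_contraction_le hα hnoise hE (K := K) (γ₀ := γ₀) N (fun i =>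
      Finset.prod_le_one (fun t _ => sq_nonneg _) fun t _ => one_sub_half_sq_le_one
        (S.step_bounds (t + 1) i).1 (by linarith [(S.step_bounds (t + 1) i).2])) (w₀ - wstar)
    have hn : ((K - 1 : ℕ) : ℝ) = K - 1 := by
      rw [Nat.cast_sub (by omega), Nat.cast_one]
    -- Neff ≤ 2(K - 1), because K > Neff - 1 and Neff ≥ 10.
    have hc : 1 / (((K - 1 : ℕ) : ℝ) * γ₀) ≤ 2 * (1 / (Neff * γ₀)) := by
      rw [hn, ← mul_div_assoc, div_le_div_iff₀ (mul_pos (by linarith) hγ) (mul_pos hNeff0 hγ)]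
      nlinarith
    have h4 := tsum_min_coord_le hα hnoise hE
      (show 0 ≤ 1 / (((K - 1 : ℕ) : ℝ) * γ₀) by positivity) k (w₀ - wstar)
    have h5 := mul_tsum_min_le_effDim (γ₀ := γ₀) hE.nonneg (summable_lam hx hE) hNeff0
      (K := K) (by linarith) (by linarith) k
    set A := ∑' i, min (lam i) (1 / (((K - 1 : ℕ) : ℝ) * γ₀)) *
      (⟪ev i, w₀ - wstar⟫ - 2 * biasCoord D wstar lam ev i) ^ 2
    set Q := sqNorm ((1 / (Neff * γ₀)) • headProj ev k + tailOp lam ev k) (w₀ - wstar) with hQ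
    have h6 : A ≤ 4 * Q + 8 * opt D := by
      refine h4.trans ?_
      rw [sqNorm_mixed hx hE] at hQ ⊢
      have ht : 0 ≤ ∑' i, lam (i + k) * ⟪ev (i + k), w₀ - wstar⟫ ^ 2 :=
        tsum_nonneg fun i => mul_nonneg (hE.nonneg _) (sq_nonneg _)
      have hh := mul_le_mul_of_nonneg_right hc (show
        0 ≤ ∑ i ∈ Finset.range k, ⟪ev i, w₀ - wstar⟫ ^ 2 from
          Finset.sum_nonneg fun i _ => sq_nonneg _)
      rw [hQ]
      linarith
    have hQ0 : 0 ≤ Q := by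
      rw [hQ, sqNorm_mixed hx hE]
      exact add_nonneg (mul_nonneg (by positivity) (Finset.sum_nonneg fun i _ => sq_nonneg _))
        (tsum_nonneg fun i => mul_nonneg (hE.nonneg _) (sq_nonneg _))
    have hws := hE.sqNorm_nonneg wstar
    have hB := hE.sqNorm_nonneg (contraction (stepSize K γ₀) (cov D) N (w₀ - wstar))
    have hsnr : (1 + snr D α σ w₀ wstar lam ev Neff γ₀ k) * σ ^ 2 =
        σ ^ 2 + α * (opt D + sqNorm (cov D) wstar + Q) := by
      rw [snr, ← hQ]
      field_simp
    rw [hsnr]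
    have hA : α * A + (16 * α * opt D + 2 * σ ^ 2) ≤
        24 * (σ ^ 2 + α * (opt D + sqNorm (cov D) wstar + Q)) := by
      have ha := mul_le_mul_of_nonneg_left h6 hα0.le
      have hb := mul_nonneg hα0.le hws
      have hd := mul_nonneg hα0.le hQ0
      have he := sq_nonneg σ
      linarith
    have hA0 : 0 ≤ α * A + (16 * α * opt D + 2 * σ ^ 2) := by
      have : 0 ≤ A := tsum_nonneg fun i =>
        mul_nonneg (le_min (hE.nonneg i) (by positivity)) (sq_nonneg _)
      positivity
    have hdim : 0 ≤ effDim lam Neff γ₀ k / Neff := by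
      refine div_nonneg (add_nonneg (Nat.cast_nonneg k) (mul_nonneg (by positivity) ?_)) hNeff0.le
      exact tsum_nonneg fun i => sq_nonneg _
    have h7 := mul_le_mul_of_nonneg_left h5 hA0
    have h8 := mul_le_mul_of_nonneg_right hA hdim
    linarith
  · have h := sqNorm_mixed_le hx hE hk (w₀ - wstar)
    rw [snr]
    gcongr
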